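/- Let $\mathbb{R}_+=(0,\infty)$, let $G=\{(u,v):u\in\mathbb{R},\,v>0\}$ carry the measure $d\nu=v^{-2}\,du\,dv$, and let $\hat g(\xi)=\int_{\mathbb{R}}g(x)e^{-2\pi i x\xi}\,dx$ denote the Fourier transform (unitary on $L_2(\mathbb{R})$, and extended to tempered distributions in the usual way). For $k\in\{0,1,2,\dots\}$ let $L_k(y)=\sum_{i=0}^k(-1)^i\binom{k}{k-i}\frac{y^i}{i!}$ be the Laguerre polynomial, $\ell_k(y)=e^{-y/2}L_k(y)$, and let $\psi^{(k)}\in L_2(\mathbb{R})$ be given by $\hat\psi^{(k)}(\xi)=\chi_{\mathbb{R}_+}(\xi)\sqrt{2\xi}\,\ell_k(2\xi)$; put $\psi^{(k)}_v(x)=v^{-1/2}\psi^{(k)}(x/v)$ for $v>0$. Let $H_2^+(\mathbb{R})$ be the space of $f\in L_2(\mathbb{R})$ with $\operatorname{supp}\hat f\subseteq[0,\infty)$, and let $A^{(k)}\subset L_2(G,d\nu)$ be the space of the functions $(u,v)\mapsto (f*\psi^{(k)}_v)(u)$ with $f\in H_2^+(\mathbb{R})$. For an essentially bounded measurable $a$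 on $G$ let $T^{(k)}_a=P^{(k)}M_a$ on $A^{(k)}$, where $M_a$ is multiplication by $a$ and $P^{(k)}$ is the orthogonal projection of $L_2(G,d\nu)$ onto $A^{(k)}$. Put $$\mathcal{B}_k(\xi,t)=\frac{2\sqrt{t\xi}}{t+\xi}\,P_k\!\left(\frac{8t\xi}{(t+\xi)^2}-1\right)\quad(\xi,t>0),\qquad P_k(x)=\frac{1}{2^kk!}\frac{d^k}{dx^k}(x^2-1)^k .$$ **Theorem.** For every $k$ the orthogonal projection $P^{(k)}$ onto $A^{(k)}$ exists (that is, $A^{(k)}$ is closed), and there is a unitary operator $R_k:A^{(k)}\to L_2(\mathbb{R}_+)$ such that, for every essentially bounded measurable symbol $b=b(u)$ on $G$ that depends only on the horizontal variable $u\in\mathbb{R}$, one has $R_kT_b^{(k)}R_k^{-1}=\mathfrak{B}_b^{(k)}$, where $\mathfrak{B}_b^{(k)}$ is the bounded operator on $L_2(\mathbb{R}_+)$ with integral kernel $\mathcal{B}_k(\xi,t)\,\hat b(\xi-t)$, in the following sense. 1. For every such $b$, with the tempered distribution $\hat b$: for all $f,g\in C_c^\infty(\mathbb{R}_+)$ the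 function $\Phi_{f,g}(s)=\int_{\mathbb{R}_+}\mathcal{B}_k(t+s,t)\,f(t)\,g(t+s)\,dt$ (with $g$ extended by $0$) is a Schwartz function on $\mathbb{R}$, and $$\int_{\mathbb{R}_+}(\mathfrak{B}_b^{(k)}f)(\xi)\,g(\xi)\,d\xi=\langle\hat b,\Phi_{f,g}\rangle .$$ 2. If moreover $b\in L_1(\mathbb{R})$ (then $\hat b$ is given by the Fourier integral) or $b\in L_2(\mathbb{R})$ (then $\hat b\in L_2(\mathbb{R})$ is the unitary Fourier transform), then for every $f\in L_2(\mathbb{R}_+)$ and almost every $\xi>0$ $$(\mathfrak{B}_b^{(k)}f)(\xi)=\int_{\mathbb{R}_+}\mathcal{B}_k(\xi,t)\,\hat b(\xi-t)\,f(t)\,dt,$$ the integral being absolutely convergent. -/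

import Mathlib

open MeasureTheory Set
open scoped ContDiff FourierTransform SchwartzMap

noncomputable section

namespace CalderonToeplitz

/-! ### The spaces `L_2(ℝ_+)` and `L_2(G, dν)` -/

/-- Lebesgue measure on `ℝ_+ = (0, ∞)`. -/
def halfLine : Measure ℝ := volume.restrict (Ioi 0)

/-- The left Haar measure `dν(u, v) = v⁻² du dv` of the `ax+b` group
`G = {(u, v) : u ∈ ℝ, v > 0}`, as a measure on `ℝ × ℝ` carried by the half-plane `v > 0`. -/
def haarG : Measure (ℝ × ℝ) :=
  (volume : Measure ℝ).prod (halfLine.withDensity fun v => ENNReal.ofReal (v ^ 2)⁻¹)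

/-! ### Laguerre functions and wavelets -/

/-- The Laguerre polynomial `L_k(y) = ∑_{i ≤ k} (-1)^i (k choose k-i) y^i / i!`. -/
def laguerre (k : ℕ) (y : ℝ) : ℝ :=
  ∑ i ∈ Finset.range (k + 1), (-1) ^ i * (k.choose (k - i) : ℝ) * y ^ i / (i.factorial : ℝ)

/-- The Laguerre function `ℓ_k(y) = e^{-y/2} L_k(y)`. -/
def laguerreFun (k : ℕ) (y : ℝ) : ℝ := Real.exp (-y / 2) * laguerre k y

/-- The Fourier transform of the wavelet: `ψ̂_k(ξ) = χ_+(ξ) √(2ξ) ℓ_k(2ξ)`. -/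
def waveletHat (k : ℕ) : ℝ → ℂ :=
  (Ioi (0 : ℝ)).indicator fun ξ => ((Real.sqrt (2 * ξ) * laguerreFun k (2 * ξ) : ℝ) : ℂ)

theorem laguerre_isBigO (k : ℕ) :
    (fun ξ : ℝ => laguerre k (2 * ξ)) =O[Filter.atTop] fun ξ : ℝ => ξ ^ k := by
  unfold laguerre
  refine Asymptotics.IsBigO.fun_sum fun i hi => ?_
  have hik : i ≤ k := Nat.lt_succ_iff.mp (Finset.mem_range.mp hi)
  have h1 : (fun ξ : ℝ => ξ ^ i) =O[Filter.atTop] fun ξ : ℝ => ξ ^ k := by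
    refine Asymptotics.IsBigO.of_bound 1 ?_
    filter_upwards [Filter.eventually_ge_atTop 1] with ξ hξ
    rw [one_mul, norm_pow, norm_pow]
    exact pow_le_pow_right₀ (by rw [Real.norm_eq_abs]; exact hξ.trans (le_abs_self ξ)) hik
  have h2 := h1.const_mul_left ((-1) ^ i * (k.choose (k - i) : ℝ) * 2 ^ i / (i.factorial : ℝ))
  refine h2.congr_left fun ξ => ?_
  ring

theorem continuous_laguerre (k : ℕ) : Continuous (laguerre k) := by
  unfold laguerre
  fun_prop

/-- `ψ̂_k` is square integrable. -/
theorem memLp_waveletHat (k : ℕ) : MemLp (waveletHat k) 2 volume := by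
  have hL := continuous_laguerre k
  have hcont : Continuous fun ξ : ℝ => Real.sqrt (2 * ξ) * laguerreFun k (2 * ξ) := by
    unfold laguerreFun
    fun_prop
  unfold waveletHat
  rw [memLp_indicator_iff_restrict measurableSet_Ioi]
  rw [memLp_two_iff_integrable_sq_norm (by
    exact (Complex.continuous_ofReal.comp hcont).aestronglyMeasurable)]
  refine integrable_of_isBigO_exp_neg (a := 0) (b := 1) one_pos ?_ ?_
  · exact ((Complex.continuous_ofReal.comp hcont).norm.pow 2).continuousOn
  · have h1 : (fun ξ : ℝ => 2 * ξ * (laguerre k (2 * ξ)) ^ 2) =O[Filter.atTop]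
        fun ξ : ℝ => ξ ^ (2 * k + 1) := by
      have := ((Asymptotics.isBigO_refl (fun ξ : ℝ => ξ) Filter.atTop).const_mul_left 2).mul
        ((laguerre_isBigO k).pow 2)
      refine this.congr_right fun ξ => ?_
      ring
    have h2 : (fun ξ : ℝ => ξ ^ (2 * k + 1)) =O[Filter.atTop] fun ξ : ℝ => Real.exp ξ := by
      simpa using (isLittleO_pow_exp_pos_mul_atTop (2 * k + 1) one_pos).isBigO
    have h3 := (h1.trans h2).mul
      (Asymptotics.isBigO_refl (fun ξ : ℝ => Real.exp (-(2 * ξ))) Filter.atTop)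
    refine (h3.congr' ?_ ?_)
    · filter_upwards [Filter.eventually_gt_atTop 0] with ξ hξ
      rw [Complex.norm_real, Real.norm_eq_abs, sq_abs, mul_pow, Real.sq_sqrt (by positivity)]
      unfold laguerreFun
      rw [mul_pow, ← Real.exp_nat_mul]
      have : ((2 : ℕ) : ℝ) * (-(2 * ξ) / 2) = -(2 * ξ) := by push_cast; ring
      rw [this]
      ring
    · filter_upwards with ξ
      rw [← Real.exp_add]
      congr 1
      ring

/-- The wavelet `ψ_k ∈ L_2(ℝ)`, the inverse of `ψ̂_k` under the unitary Fourier transform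
`ĝ(ξ) = ∫ g(x) e^{-2πixξ} dx` of `L_2(ℝ)`. -/
def wavelet (k : ℕ) : Lp ℂ 2 (volume : Measure ℝ) :=
  𝓕⁻ ((memLp_waveletHat k).toLp (waveletHat k))

/-- The dilation `ψ_{k,v}(x) = v^{-1/2} ψ_k(x / v)`, for `v > 0`. -/
def dilatedWavelet (k : ℕ) (v x : ℝ) : ℂ :=
  (((Real.sqrt v)⁻¹ : ℝ) : ℂ) * wavelet k (x / v)

/-- The Hardy space `H_2^+(ℝ)`: the `L_2`-functions whose Fourier transform is supported in
`[0, ∞)`. -/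
def hardySpace : Submodule ℂ (Lp ℂ 2 (volume : Measure ℝ)) where
  carrier := {h | ∀ᵐ ξ ∂(volume : Measure ℝ), ξ < 0 → (𝓕 h : Lp ℂ 2 (volume : Measure ℝ)) ξ = 0}
  add_mem' := by
    intro a b ha hb
    simp only [mem_ofPred_eq, FourierTransform.fourier_add] at *
    filter_upwards [ha, hb, Lp.coeFn_add (𝓕 a) (𝓕 b)] with ξ h1 h2 h3 h
    rw [h3, Pi.add_apply, h1 h, h2 h, add_zero]
  zero_mem' := by
    have h0 : 𝓕 (0 : Lp ℂ 2 (volume : Measure ℝ)) = 0 := map_zero (Lp.fourierTransformₗᵢ ℝ ℂ)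
    simp only [mem_ofPred_eq, h0]
    filter_upwards [Lp.coeFn_zero ℂ 2 (volume : Measure ℝ)] with ξ h1 _
    rw [h1, Pi.zero_apply]
  smul_mem' := by
    intro c a ha
    simp only [mem_ofPred_eq, FourierTransform.fourier_smul] at *
    filter_upwards [ha, Lp.coeFn_smul c (𝓕 a)] with ξ h1 h2 h
    rw [h2, Pi.smul_apply, h1 h, smul_zero]

/-- The continuous wavelet transform
`(W_k f)(u, v) = (f * ψ_{k,v})(u) = ∫ f(x) ψ_{k,v}(u - x) dx`. -/
def waveletTransform (k : ℕ) (f : Lp ℂ 2 (volume : Measure ℝ)) (z : ℝ × ℝ) : ℂ :=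
  ∫ x, f x * dilatedWavelet k z.2 (z.1 - x)

theorem integrable_mul_dilatedWavelet (k : ℕ) (f : Lp ℂ 2 (volume : Measure ℝ)) (u v : ℝ) :
    Integrable fun x => f x * dilatedWavelet k v (u - x) := by
  rcases le_or_gt v 0 with hv | hv
  · have : ∀ x, f x * dilatedWavelet k v (u - x) = 0 := fun x => by
      simp [dilatedWavelet, Real.sqrt_eq_zero_of_nonpos hv]
    simp [this]
  · have hmeas : StronglyMeasurable fun x : ℝ => wavelet k ((u - x) / v) :=
      (Lp.stronglyMeasurable (wavelet k)).comp_measurable (by fun_prop)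
    have hm : MemLp (fun x : ℝ => wavelet k ((u - x) / v)) 2 volume := by
      rw [memLp_two_iff_integrable_sq_norm hmeas.aestronglyMeasurable]
      have h0 := (memLp_two_iff_integrable_sq_norm
        (Lp.aestronglyMeasurable (wavelet k))).1 (Lp.memLp (wavelet k))
      exact (h0.comp_div hv.ne').comp_sub_left u
    exact (Lp.memLp f).integrable_mul (hm.const_mul _)

/-- The wavelet subspace `A_k = {W_k f : f ∈ H_2^+(ℝ)}` of `L_2(G, dν)`. -/
def waveletSpace (k : ℕ) : Submodule ℂ (Lp ℂ 2 haarG) where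
  carrier := {F | ∃ f ∈ hardySpace, F =ᵐ[haarG] waveletTransform k f}
  add_mem' := by
    rintro F F' ⟨f, hf, h⟩ ⟨f', hf', h'⟩
    refine ⟨f + f', add_mem hf hf', ?_⟩
    filter_upwards [h, h', Lp.coeFn_add F F'] with z h1 h2 h3
    rw [h3, Pi.add_apply, h1, h2]
    unfold waveletTransform
    rw [← integral_add (integrable_mul_dilatedWavelet k f z.1 z.2)
      (integrable_mul_dilatedWavelet k f' z.1 z.2)]
    refine integral_congr_ae ?_
    filter_upwards [Lp.coeFn_add f f'] with x hx
    rw [hx, Pi.add_apply, add_mul]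
  zero_mem' := by
    refine ⟨0, zero_mem _, ?_⟩
    filter_upwards [Lp.coeFn_zero ℂ 2 haarG] with z h1
    rw [h1, Pi.zero_apply]
    unfold waveletTransform
    simp
  smul_mem' := by
    rintro c F ⟨f, hf, h⟩
    refine ⟨c • f, Submodule.smul_mem _ c hf, ?_⟩
    filter_upwards [h, Lp.coeFn_smul c F] with z h1 h2
    rw [h2, Pi.smul_apply, h1]
    unfold waveletTransform
    rw [smul_eq_mul, ← integral_const_mul]
    refine integral_congr_ae ?_
    filter_upwards [Lp.coeFn_smul c f] with x hx
    rw [hx, Pi.smul_apply, smul_eq_mul, mul_assoc]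

/-! ### Calderón–Toeplitz operators -/

/-- The operator `M_a` of multiplication by `a ∈ L_∞(G)` on `L_2(G, dν)`. -/
def mulOp {a : ℝ × ℝ → ℂ} (ha : MemLp a ⊤ haarG) : Lp ℂ 2 haarG →L[ℂ] Lp ℂ 2 haarG :=
  (ContinuousLinearMap.mul ℂ ℂ).holderL haarG ⊤ 2 2 (ha.toLp a)

/-- The Calderón–Toeplitz operator `T_a = P M_a` on `A_k`, where `P` is the orthogonal projection
of `L_2(G, dν)` onto `A_k`. -/
def toeplitzOp (k : ℕ) [(waveletSpace k).HasOrthogonalProjection] {a : ℝ × ℝ → ℂ}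
    (ha : MemLp a ⊤ haarG) : waveletSpace k →L[ℂ] waveletSpace k :=
  (waveletSpace k).orthogonalProjectionOnto ∘L mulOp ha ∘L (waveletSpace k).subtypeL

/-- An essentially bounded function `b = b(u)` on `ℝ` is an essentially bounded symbol on `G`. -/
theorem memLp_horizontal {b : ℝ → ℂ} (hb : MemLp b ⊤ volume) :
    MemLp (fun z : ℝ × ℝ => b z.1) ⊤ haarG := by
  have hq : Measure.QuasiMeasurePreserving (Prod.fst : ℝ × ℝ → ℝ) haarG volume :=
    Measure.quasiMeasurePreserving_fst
  refine memLp_top_of_bound (hb.1.comp_quasiMeasurePreserving hq)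
    (eLpNormEssSup b volume).toReal ?_
  have h : ∀ᵐ u ∂(volume : Measure ℝ), ‖b u‖ ≤ (eLpNormEssSup b volume).toReal := by
    have hfin : eLpNormEssSup b volume ≠ ⊤ := by
      have := hb.2.ne
      rwa [eLpNorm_exponent_top] at this
    filter_upwards [ae_le_eLpNormEssSup (f := b) (μ := volume)] with u hu
    rw [← toReal_enorm]
    exact ENNReal.toReal_mono hfin hu
  exact hq.ae h

/-! ### The kernel -/

/-- The Legendre polynomial `P_n(x) = (1 / (2^n n!)) (d/dx)^n (x^2 - 1)^n`. -/
def legendre (n : ℕ) (x : ℝ) : ℝ :=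
  1 / (2 ^ n * (n.factorial : ℝ)) * iteratedDeriv n (fun y : ℝ => (y ^ 2 - 1) ^ n) x

/-- `B_k(ξ, t) = (2 √(tξ) / (t + ξ)) P_k(8tξ / (t + ξ)^2 - 1)`, for `ξ, t > 0`. -/
def kernelB (k : ℕ) (ξ t : ℝ) : ℝ :=
  2 * Real.sqrt (t * ξ) / (t + ξ) * legendre k (8 * t * ξ / (t + ξ) ^ 2 - 1)

/-- `T` is the integral operator on `L_2(ℝ_+)` with kernel `K`: for each `f ∈ L_2(ℝ_+)` and almost
every `ξ > 0` the integral `∫_0^∞ K(ξ, t) f(t) dt` converges absolutely and equals `(T f)(ξ)`. -/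
def IsIntegralOperator (K : ℝ → ℝ → ℂ) (T : Lp ℂ 2 halfLine →L[ℂ] Lp ℂ 2 halfLine) : Prop :=
  ∀ f : Lp ℂ 2 halfLine, ∀ᵐ ξ ∂halfLine,
    Integrable (fun t => K ξ t * f t) halfLine ∧ T f ξ = ∫ t, K ξ t * f t ∂halfLine

/-- `T` is the integral operator on `L_2(ℝ_+)` with the distributional kernel `B(ξ, t) β(ξ - t)`,
where `β` is a tempered distribution: for all test functions `f, g ∈ C_c^∞(ℝ_+)` the pairing
`∫_0^∞ (T f)(ξ) g(ξ) dξ = ∫_0^∞ ∫_0^∞ B(ξ, t) β(ξ - t) f(t) g(ξ) dt dξ` holds, where the right-hand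
side is, with `s = ξ - t`, the value of `β` at the test function
`s ↦ ∫_0^∞ B(t + s, t) f(t) g(t + s) dt`. As `C_c^∞(ℝ_+)` is dense in `L_2(ℝ_+)`, this
determines the bounded operator `T`. -/
def IsDistributionalIntegralOperator (B : ℝ → ℝ → ℝ) (β : 𝓢'(ℝ, ℂ))
    (T : Lp ℂ 2 halfLine →L[ℂ] Lp ℂ 2 halfLine) : Prop :=
  ∀ f g : ℝ → ℂ, ContDiff ℝ ∞ f → HasCompactSupport f → tsupport f ⊆ Ioi 0 →
    ContDiff ℝ ∞ g → HasCompactSupport g → tsupport g ⊆ Ioi 0 →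
    ∃ Φ : 𝓢(ℝ, ℂ),
      (∀ s, Φ s = ∫ t, (B (t + s) t : ℂ) * f t * g (t + s) ∂halfLine) ∧
      ∀ F : Lp ℂ 2 halfLine, F =ᵐ[halfLine] f → ∫ ξ, T F ξ * g ξ ∂halfLine = β Φ

/-- The Fourier transform `b̂`, as a tempered distribution, of an essentially bounded function. -/
def fourierDist {b : ℝ → ℂ} (hb : MemLp b ⊤ volume) : 𝓢'(ℝ, ℂ) :=
  𝓕 (Lp.toTemperedDistribution (hb.toLp b))

end CalderonToeplitz

end

noncomputable section

namespace CalderonToeplitz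

/-! ### Legendre polynomials and the overlap integral of Laguerre functions -/

/-! Convolution becomes multiplication on the Fourier side: for fixed `v` the function `f * ψ_v` has
Fourier transform `m_v · 𝓕 f`, where `m_v` is `dilatedSymbol k v`. This real symbol vanishes for
frequencies `≤ 0`. Everything rests on the overlap integral `∫ m_v(ξ) m_v(t) v⁻² dv = B_k(ξ, t)`
(`integral_dilatedSymbol_mul`), which comes from a Laplace-type integral of two Laguerre functions
and a binomial identity for Legendre polynomials.

On the diagonal the overlap is `B_k(ξ, ξ) = P_k(1) = 1`. With Plancherel in `u` and Tonelli in `v`,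
this makes `φ ↦ 𝓕⁻(m_v φ)(u)` an isometry of `L_2(ℝ_+)` into `L_2(G, dν)`. Its range is `A_k`
(`range_synthesisₗᵢ`), so `A_k` is closed and the inverse of this map is the required unitary.

Off the diagonal the overlap gives the kernel. In the matrix coefficient of `T_b` between two test
functions, `b(u)` multiplies an integral over `v` alone. The overlap formula and the substitution `s
= ξ - t` turn that integral into `𝓕 Φ_{f,g}(u)` (`integral_fourier_mul_synthesis`). Hence the
coefficient is `∫ b · 𝓕 Φ_{f,g} = ⟨𝓕 b, Φ_{f,g}⟩`.

For `b ∈ L_2` the bound `|B_k| ≤ 1` makes all the integrals absolutely convergent. The weak identity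
is extended to every `F` through the adjoint (`integral_halfLineOp_mul`) and then turned into a
pointwise one by Fubini and testing (`isIntegralOperator_halfLineOp`). Since `b` is bounded, the
`L_1` case reduces to the `L_2` case. -/

/-- Leibniz rule applied to `(x - 1)^n (x + 1)^n` in the Rodrigues formula. -/
theorem legendre_eq_sum (n : ℕ) (x : ℝ) :
    legendre n x = 1 / 2 ^ n * ∑ m ∈ Finset.range (n + 1),
      (n.choose m : ℝ) ^ 2 * ((x - 1) ^ m * (x + 1) ^ (n - m)) := by
  have h1 : (fun y : ℝ => (y ^ 2 - 1) ^ n) = fun y : ℝ =>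
      (((Polynomial.X - Polynomial.C (1 : ℝ)) ^ n
        * (Polynomial.X - Polynomial.C (-1 : ℝ)) ^ n).eval y) := by
    funext y
    simp only [Polynomial.eval_mul, Polynomial.eval_pow, Polynomial.eval_sub, Polynomial.eval_X,
      Polynomial.eval_C, ← mul_pow]
    ring
  have h2 : ∀ p : Polynomial ℝ, iteratedDeriv n (fun y => p.eval y) x
      = (Polynomial.derivative^[n] p).eval x := by
    intro p
    rw [iteratedDeriv_eq_iterate]
    generalize n = m
    induction m generalizing p with
    | zero => rfl
    | succ m ih =>
      rw [Function.iterate_succ_apply, Function.iterate_succ_apply, ← ih]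
      have : deriv (fun y => p.eval y) = fun y => (Polynomial.derivative p).eval y :=
        funext fun y => p.deriv
      rw [this]
  unfold legendre
  rw [h1, h2, Polynomial.iterate_derivative_mul, Polynomial.eval_finsetSum, Finset.mul_sum,
    Finset.mul_sum]
  refine Finset.sum_congr rfl fun m hm => ?_
  have hmn : m ≤ n := Nat.lt_succ_iff.mp (Finset.mem_range.mp hm)
  rw [Polynomial.iterate_derivative_X_sub_pow, Polynomial.iterate_derivative_X_sub_pow,
    Nat.sub_sub_self hmn]
  simp only [nsmul_eq_mul, Polynomial.eval_mul, Polynomial.eval_natCast,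
    Polynomial.eval_pow, Polynomial.eval_sub, Polynomial.eval_X, Polynomial.eval_C]
  -- The two derivatives supply a second binomial coefficient, hence the square, and the `n!` that
  -- cancels the normalisation.
  have h3 : (n.descFactorial (n - m) : ℝ) * n.descFactorial m = n.choose m * n.factorial := by
    rw [Nat.descFactorial_eq_factorial_mul_choose, Nat.descFactorial_eq_factorial_mul_choose,
      Nat.choose_symm hmn, ← Nat.choose_mul_factorial_mul_factorial hmn]
    push_cast
    ring
  have hf : (n.factorial : ℝ) ≠ 0 := by positivity
  have h4 : x - -1 = x + 1 := by ring
  rw [h4]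
  field_simp
  linear_combination ((n.choose m : ℝ) * (x-1)^m * (x+1)^(n-m)) * h3

theorem contDiff_legendre (n : ℕ) : ContDiff ℝ ∞ (legendre n) := by
  have : legendre n = fun x => 1 / 2 ^ n * ∑ m ∈ Finset.range (n + 1),
      (n.choose m : ℝ) ^ 2 * ((x - 1) ^ m * (x + 1) ^ (n - m)) := funext (legendre_eq_sum n)
  rw [this]
  fun_prop

theorem sum_choose_mul_choose_mul_pow (k m : ℕ) (hm : m ≤ k) (x : ℝ) :
    ∑ i ∈ Finset.range (k + 1), (k.choose i : ℝ) * i.choose m * x ^ i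
      = k.choose m * x ^ m * (1 + x) ^ (k - m) := by
  have h0 : k + 1 = m + (k - m + 1) := by omega
  rw [h0, Finset.sum_range_add, Finset.sum_eq_zero, zero_add, add_comm 1 x, add_pow,
    Finset.mul_sum]
  · refine Finset.sum_congr rfl fun j hj => ?_
    have hj' : j ≤ k - m := Nat.lt_succ_iff.mp (Finset.mem_range.mp hj)
    have := Nat.choose_mul (n := k) (k := m + j) (s := m) (by omega)
    rw [Nat.add_sub_cancel_left] at this
    have h' : (k.choose (m + j) : ℝ) * (m + j).choose m = k.choose m * (k - m).choose j := by
      exact_mod_cast this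
    rw [h', one_pow, pow_add]
    ring
  · intro i hi
    rw [Nat.choose_eq_zero_of_lt (Finset.mem_range.mp hi)]
    simp

/-- Vandermonde's identity. The range is padded with zero terms up to `k`, so that it no longer
depends on `i` and the sums can be interchanged. -/
theorem choose_add_eq_sum (k i j : ℕ) (hi : i ≤ k) :
    ((i + j).choose i : ℝ) = ∑ m ∈ Finset.range (k + 1), (i.choose m : ℝ) * j.choose m := by
  have h : (i + j).choose i = ∑ m ∈ Finset.range (i + 1), i.choose m * j.choose m := by
    rw [Nat.add_choose_eq, Finset.Nat.sum_antidiagonal_eq_sum_range_succ_mk,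
      ← Finset.sum_range_reflect]
    refine Finset.sum_congr rfl fun m hm => ?_
    have hm' : m ≤ i := Nat.lt_succ_iff.mp (Finset.mem_range.mp hm)
    have e1 : i + 1 - 1 - m = i - m := by omega
    simp only [e1, Nat.choose_symm hm', Nat.sub_sub_self hm']
  rw [h]
  push_cast
  refine Finset.sum_subset (Finset.range_subset_range.2 (by omega)) fun m _ hm => ?_
  rw [Nat.choose_eq_zero_of_lt (by simpa using hm)]
  simp

/-- Vandermonde decouples `i` from `j`, and each single sum closes to a binomial power. This leaves
squared binomials times powers of `xy` and `(1 - x)(1 - y)`. Since `x + y = 2`, the latter product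
is `xy - 1`, so with `z = 2xy - 1` the two bases are `(z + 1)/2` and `(z - 1)/2`. -/
theorem sum_sum_choose_eq_legendre (k : ℕ) (x y : ℝ) (hxy : x + y = 2) :
    ∑ i ∈ Finset.range (k + 1), ∑ j ∈ Finset.range (k + 1),
      (k.choose i : ℝ) * k.choose j * (i + j).choose i * ((-x) ^ i * (-y) ^ j)
      = legendre k (2 * (x * y) - 1) := by
  have h1 : ∑ i ∈ Finset.range (k + 1), ∑ j ∈ Finset.range (k + 1),
      (k.choose i : ℝ) * k.choose j * (i + j).choose i * ((-x) ^ i * (-y) ^ j)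
      = ∑ m ∈ Finset.range (k + 1), (∑ i ∈ Finset.range (k + 1),
        (k.choose i : ℝ) * i.choose m * (-x) ^ i) *
        (∑ j ∈ Finset.range (k + 1), (k.choose j : ℝ) * j.choose m * (-y) ^ j) := by
    simp_rw [Finset.sum_mul_sum]
    rw [eq_comm, Finset.sum_comm]
    refine Finset.sum_congr rfl fun i hi => ?_
    rw [Finset.sum_comm]
    refine Finset.sum_congr rfl fun j hj => ?_
    rw [choose_add_eq_sum k i j (Nat.lt_succ_iff.mp (Finset.mem_range.mp hi)), Finset.mul_sum,
      Finset.sum_mul]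
    exact Finset.sum_congr rfl fun m _ => by ring
  rw [h1, legendre_eq_sum, ← Finset.sum_range_reflect, Finset.mul_sum]
  refine Finset.sum_congr rfl fun m hm => ?_
  have hm' : m ≤ k := Nat.lt_succ_iff.mp (Finset.mem_range.mp hm)
  have e1 : k + 1 - 1 - m = k - m := by omega
  rw [e1, sum_choose_mul_choose_mul_pow k _ (by omega),
    sum_choose_mul_choose_mul_pow k _ (by omega), Nat.sub_sub_self hm', Nat.choose_symm hm']
  obtain rfl : y = 2 - x := by linarith
  have e2 : 2 * (x * (2 - x)) - 1 - 1 = 2 * ((1 + -x) * (1 + -(2 - x))) := by ring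
  have e3 : 2 * (x * (2 - x)) - 1 + 1 = 2 * (-x * -(2 - x)) := by ring
  have e4 : (2 : ℝ) ^ k = 2 ^ m * 2 ^ (k - m) := by rw [← pow_add]; congr 1; omega
  rw [e2, e3, e4]
  simp only [mul_pow]
  field_simp

/-! ### Laplace integrals and the overlap of two Laguerre functions. -/

theorem integral_pow_mul_exp_neg (n : ℕ) {r : ℝ} (hr : 0 < r) :
    ∫ v in Ioi (0 : ℝ), v ^ n * Real.exp (-(r * v)) = n.factorial / r ^ (n + 1) := by
  have h := Real.integral_rpow_mul_exp_neg_mul_Ioi (a := n + 1) (r := r) (by positivity) hr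
  have e : (n : ℝ) + 1 - 1 = n := by ring
  simp only [e, Real.rpow_natCast, Real.Gamma_nat_eq_factorial] at h
  rw [h]
  have : (n : ℝ) + 1 = ((n + 1 : ℕ) : ℝ) := by push_cast; ring
  rw [this, Real.rpow_natCast, one_div, inv_pow, div_eq_mul_inv, mul_comm]

theorem integrableOn_pow_mul_exp_neg (n : ℕ) {r : ℝ} (hr : 0 < r) :
    IntegrableOn (fun v : ℝ => v ^ n * Real.exp (-(r * v))) (Ioi 0) := by
  -- A non-integrable function would have integral `0` by convention, contradicting the positive
  -- value just computed.
  by_contra h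
  have h1 := integral_pow_mul_exp_neg n hr
  rw [integral_undef h] at h1
  have : (0 : ℝ) < n.factorial / r ^ (n + 1) := by positivity
  linarith

theorem laguerreFun_mul_laguerreFun (k : ℕ) (ξ t v : ℝ) :
    laguerreFun k (2 * v * ξ) * laguerreFun k (2 * v * t)
      = ∑ i ∈ Finset.range (k + 1), ∑ j ∈ Finset.range (k + 1),
        ((-1) ^ (i + j) * (k.choose i : ℝ) * k.choose j * ((2 * ξ) ^ i * (2 * t) ^ j)
          / (i.factorial * j.factorial)) * (v ^ (i + j) * Real.exp (-((ξ + t) * v))) := by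
  have he : Real.exp (-(2 * v * ξ) / 2) * Real.exp (-(2 * v * t) / 2)
      = Real.exp (-((ξ + t) * v)) := by
    rw [← Real.exp_add]; congr 1; ring
  have : laguerreFun k (2 * v * ξ) * laguerreFun k (2 * v * t)
      = Real.exp (-((ξ + t) * v)) * (laguerre k (2 * v * ξ) * laguerre k (2 * v * t)) := by
    rw [← he]; unfold laguerreFun; ring
  rw [this]
  unfold laguerre
  rw [Finset.sum_mul_sum, Finset.mul_sum]
  refine Finset.sum_congr rfl fun i hi => ?_
  rw [Finset.mul_sum]
  refine Finset.sum_congr rfl fun j hj => ?_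
  rw [Nat.choose_symm (Nat.lt_succ_iff.mp (Finset.mem_range.mp hi)),
    Nat.choose_symm (Nat.lt_succ_iff.mp (Finset.mem_range.mp hj))]
  simp only [mul_pow, pow_add]
  field_simp

theorem integrableOn_laguerreFun_mul (k : ℕ) {ξ t : ℝ} (h : 0 < ξ + t) :
    IntegrableOn (fun v => laguerreFun k (2 * v * ξ) * laguerreFun k (2 * v * t)) (Ioi 0) := by
  simp_rw [laguerreFun_mul_laguerreFun]
  exact integrable_finsetSum _ fun i _ => integrable_finsetSum _ fun j _ =>
    (integrableOn_pow_mul_exp_neg _ h).const_mul _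

/-- Termwise integration produces `(i + j)!/(i! j!)`, which is the binomial coefficient in
`sum_sum_choose_eq_legendre` with `x = 2ξ/(t + ξ)` and `y = 2t/(t + ξ)`. -/
theorem integral_laguerreFun_mul (k : ℕ) {ξ t : ℝ} (h : 0 < ξ + t) :
    ∫ v in Ioi (0 : ℝ), laguerreFun k (2 * v * ξ) * laguerreFun k (2 * v * t)
      = 1 / (t + ξ) * legendre k (8 * t * ξ / (t + ξ) ^ 2 - 1) := by
  simp_rw [laguerreFun_mul_laguerreFun]
  rw [integral_finsetSum _ fun i _ => integrable_finsetSum _ fun j _ =>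
    (integrableOn_pow_mul_exp_neg _ h).const_mul _]
  have hs : t + ξ ≠ 0 := by linarith
  have hx : 2 * ξ / (t + ξ) + 2 * t / (t + ξ) = 2 := by field_simp; ring
  have e : 8 * t * ξ / (t + ξ) ^ 2 - 1 = 2 * ((2 * ξ / (t + ξ)) * (2 * t / (t + ξ))) - 1 := by
    field_simp; ring
  rw [e, ← sum_sum_choose_eq_legendre k _ _ hx, Finset.mul_sum]
  refine Finset.sum_congr rfl fun i _ => ?_
  rw [integral_finsetSum _ fun j _ => (integrableOn_pow_mul_exp_neg _ h).const_mul _,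
    Finset.mul_sum]
  refine Finset.sum_congr rfl fun j _ => ?_
  rw [integral_const_mul, integral_pow_mul_exp_neg _ h]
  have hc : ((i + j).choose i : ℝ) * (i.factorial * j.factorial) = (i + j).factorial := by
    have := Nat.choose_mul_factorial_mul_factorial (Nat.le_add_right i j)
    rw [Nat.add_sub_cancel_left, mul_assoc] at this
    exact_mod_cast this
  rw [← hc, add_comm ξ t, ← neg_div, ← neg_div, div_pow, div_pow, neg_pow (2 * ξ), neg_pow (2 * t)]
  simp only [pow_add]
  field_simp

/-! ### The Fourier transform on `L_1 ∩ L_2` -/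

theorem continuous_fourier_of_integrable {p : ℝ → ℂ} (hp : Integrable p) : Continuous (𝓕 p) :=
  VectorFourier.fourierIntegral_continuous Real.continuous_fourierChar continuous_inner hp

theorem continuous_fourierInv_of_integrable {p : ℝ → ℂ} (hp : Integrable p) :
    Continuous (𝓕⁻ p) := by
  have : 𝓕⁻ p = fun x => 𝓕 p (-x) := funext fun x => Real.fourierInv_eq_fourier_neg p x
  rw [this]
  exact (continuous_fourier_of_integrable hp).comp continuous_neg

/-- Both transforms move onto a test function: the `L_2` one through tempered distributions, the
integral one through Fubini. They therefore have the same integrals against smooth compactly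
supported functions. -/
theorem coeFn_fourier_toLp {p : ℝ → ℂ} (hp : Integrable p) (hp2 : MemLp p 2) :
    (𝓕 (hp2.toLp p) : Lp ℂ 2 (volume : Measure ℝ)) =ᵐ[volume] 𝓕 p := by
  refine ae_eq_of_integral_contDiff_smul_eq ((Lp.memLp _).locallyIntegrable one_le_two)
    (continuous_fourier_of_integrable hp).locallyIntegrable fun g hg hgc => ?_
  have hg₁ : HasCompactSupport (Complex.ofRealCLM ∘ g) := hgc.comp_left rfl
  have hg₂ : ContDiff ℝ ∞ (Complex.ofRealCLM ∘ g) := by fun_prop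
  set G : 𝓢(ℝ, ℂ) := hg₁.toSchwartzMap hg₂ with hG
  have h1 := congrArg (fun T : 𝓢'(ℝ, ℂ) => T G) (Lp.fourier_toTemperedDistribution_eq (hp2.toLp p))
  simp only [TemperedDistribution.fourier_apply, Lp.toTemperedDistribution_apply] at h1
  have h2 : ∫ ξ, 𝓕 (G : ℝ → ℂ) ξ • p ξ = ∫ x, G x • 𝓕 p x := by
    simpa only [flip_innerₗ] using! VectorFourier.integral_fourierIntegral_smul_eq_flip
      (L := innerₗ ℝ) Real.continuous_fourierChar continuous_inner G.integrable hp
  have h3 : ∫ x, 𝓕 G x • (hp2.toLp p) x = ∫ ξ, 𝓕 (G : ℝ → ℂ) ξ • p ξ := by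
    refine integral_congr_ae ?_
    filter_upwards [hp2.coeFn_toLp] with x hx
    rw [hx, SchwartzMap.fourier_coe]
  have h4 : ∀ x, G x = (g x : ℂ) := fun x => rfl
  rw [h3, h2] at h1
  simp only [h4] at h1
  simpa using h1.symm

theorem coeFn_fourierInv_toLp {p : ℝ → ℂ} (hp : Integrable p) (hp2 : MemLp p 2) :
    (𝓕⁻ (hp2.toLp p) : Lp ℂ 2 (volume : Measure ℝ)) =ᵐ[volume] 𝓕⁻ p := by
  refine ae_eq_of_integral_contDiff_smul_eq ((Lp.memLp _).locallyIntegrable one_le_two)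
    (continuous_fourierInv_of_integrable hp).locallyIntegrable fun g hg hgc => ?_
  have hg₁ : HasCompactSupport (Complex.ofRealCLM ∘ g) := hgc.comp_left rfl
  have hg₂ : ContDiff ℝ ∞ (Complex.ofRealCLM ∘ g) := by fun_prop
  set G : 𝓢(ℝ, ℂ) := hg₁.toSchwartzMap hg₂ with hG
  have h1 := congrArg (fun T : 𝓢'(ℝ, ℂ) => T G)
    (Lp.fourierInv_toTemperedDistribution_eq (hp2.toLp p))
  simp only [TemperedDistribution.fourierInv_apply, Lp.toTemperedDistribution_apply] at h1
  have h2 : ∫ ξ, 𝓕⁻ (G : ℝ → ℂ) ξ • p ξ = ∫ x, G x • 𝓕⁻ p x := by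
    have e : (-innerₗ ℝ).flip = -innerₗ ℝ := by ext; simp
    simpa only [e] using! VectorFourier.integral_fourierIntegral_smul_eq_flip
      (L := -innerₗ ℝ) Real.continuous_fourierChar continuous_inner.neg G.integrable hp
  have h3 : ∫ x, 𝓕⁻ G x • (hp2.toLp p) x = ∫ ξ, 𝓕⁻ (G : ℝ → ℂ) ξ • p ξ := by
    refine integral_congr_ae ?_
    filter_upwards [hp2.coeFn_toLp] with x hx
    rw [hx, SchwartzMap.fourierInv_coe]
  have h4 : ∀ x, G x = (g x : ℂ) := fun x => rfl
  rw [h3, h2] at h1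
  simp only [h4] at h1
  simpa using h1.symm

theorem lintegral_enorm_fourierInv_sq {p : ℝ → ℂ} (hp : Integrable p) (hp2 : MemLp p 2) :
    ∫⁻ u, ‖𝓕⁻ p u‖ₑ ^ 2 = ∫⁻ ξ, ‖p ξ‖ₑ ^ 2 := by
  have h : eLpNorm (𝓕⁻ p) 2 volume = eLpNorm p 2 volume := by
    rw [← eLpNorm_congr_ae (coeFn_fourierInv_toLp hp hp2), ← eLpNorm_congr_ae hp2.coeFn_toLp,
      ← Lp.enorm_def, ← Lp.enorm_def]
    rw [← ofReal_norm, ← ofReal_norm]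
    exact congrArg ENNReal.ofReal ((Lp.fourierTransformₗᵢ ℝ ℂ).symm.norm_map (hp2.toLp p))
  have h2 := congrArg (fun x => x ^ (2 : ℝ)) h
  simp only [eLpNorm_eq_lintegral_rpow_enorm_toReal two_ne_zero ENNReal.ofNat_ne_top,
    ← ENNReal.rpow_mul] at h2
  simpa using h2

/-! ### The dilated symbol of the wavelet -/

/-- The Haar measure `v⁻² dv` in the scale variable `v > 0`. -/
def scaleMeasure : Measure ℝ := halfLine.withDensity fun v => ENNReal.ofReal (v ^ 2)⁻¹

instance : SFinite scaleMeasure := by unfold scaleMeasure halfLine; infer_instance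

instance : SFinite halfLine := by unfold halfLine; infer_instance

theorem haarG_eq_prod : haarG = (volume : Measure ℝ).prod scaleMeasure := rfl

/-- The Fourier transform of `ψ_{k,v}` at `ξ`, which vanishes for `ξ ≤ 0 < v`. -/
def dilatedSymbol (k : ℕ) (v ξ : ℝ) : ℝ :=
  Real.sqrt v * (Real.sqrt (2 * v * ξ) * laguerreFun k (2 * v * ξ))

theorem continuous_laguerreFun (k : ℕ) : Continuous (laguerreFun k) := by
  have := continuous_laguerre k
  unfold laguerreFun
  fun_prop

theorem continuous_dilatedSymbol (k : ℕ) :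
    Continuous fun z : ℝ × ℝ => dilatedSymbol k z.1 z.2 := by
  have := continuous_laguerreFun k
  unfold dilatedSymbol
  fun_prop

theorem dilatedSymbol_of_nonpos (k : ℕ) {v ξ : ℝ} (hv : 0 < v) (hξ : ξ ≤ 0) :
    dilatedSymbol k v ξ = 0 := by
  unfold dilatedSymbol
  rw [Real.sqrt_eq_zero_of_nonpos (x := 2 * v * ξ)
    (mul_nonpos_of_nonneg_of_nonpos (by positivity) hξ)]
  ring

theorem waveletHat_mul (k : ℕ) {v : ℝ} (hv : 0 < v) (ξ : ℝ) :
    (Real.sqrt v : ℂ) * waveletHat k (v * ξ) = dilatedSymbol k v ξ := by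
  rcases le_or_gt ξ 0 with h | h
  · rw [dilatedSymbol_of_nonpos k hv h, waveletHat, indicator_of_notMem]
    · simp
    · exact not_lt.2 (mul_nonpos_of_nonneg_of_nonpos hv.le h)
  · rw [waveletHat, indicator_of_mem (mem_Ioi.2 (mul_pos hv h)), dilatedSymbol]
    push_cast
    rw [mul_assoc 2 v ξ]

theorem ae_scaleMeasure_pos : ∀ᵐ v ∂scaleMeasure, 0 < v :=
  (withDensity_absolutelyContinuous _ _).ae_le (ae_restrict_mem measurableSet_Ioi)

theorem smul_dilatedSymbol_mul (k : ℕ) {ξ t v : ℝ} (hξ : 0 < ξ) (ht : 0 < t) (hv : 0 < v) :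
    (ENNReal.ofReal (v ^ 2)⁻¹).toReal • (dilatedSymbol k v ξ * dilatedSymbol k v t)
      = 2 * Real.sqrt (t * ξ) * (laguerreFun k (2 * v * ξ) * laguerreFun k (2 * v * t)) := by
  rw [ENNReal.toReal_ofReal (by positivity), smul_eq_mul]
  unfold dilatedSymbol
  have h1 : Real.sqrt v * Real.sqrt v = v := Real.mul_self_sqrt hv.le
  have h2 : Real.sqrt (2 * v * ξ) * Real.sqrt (2 * v * t) = 2 * v * Real.sqrt (t * ξ) := by
    rw [← Real.sqrt_mul (by positivity)]
    have : 2 * v * ξ * (2 * v * t) = (2 * v) ^ 2 * (t * ξ) := by ring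
    rw [this, Real.sqrt_mul (by positivity), Real.sqrt_sq (by positivity)]
  calc _ = (v ^ 2)⁻¹ * ((Real.sqrt v * Real.sqrt v)
        * (Real.sqrt (2 * v * ξ) * Real.sqrt (2 * v * t))
        * (laguerreFun k (2 * v * ξ) * laguerreFun k (2 * v * t))) := by ring
    _ = _ := by rw [h1, h2]; field_simp

theorem measurable_density : Measurable fun v : ℝ => ENNReal.ofReal (v ^ 2)⁻¹ := by fun_prop

theorem integrable_dilatedSymbol_mul (k : ℕ) {ξ t : ℝ} (hξ : 0 < ξ) (ht : 0 < t) :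
    Integrable (fun v => dilatedSymbol k v ξ * dilatedSymbol k v t) scaleMeasure := by
  rw [scaleMeasure, integrable_withDensity_iff_integrable_smul' measurable_density (by simp)]
  refine ((integrableOn_laguerreFun_mul k (add_pos hξ ht)).const_mul
    (2 * Real.sqrt (t * ξ))).congr ?_
  filter_upwards [ae_restrict_mem measurableSet_Ioi] with v hv
  exact (smul_dilatedSymbol_mul k hξ ht hv).symm

theorem integral_dilatedSymbol_mul (k : ℕ) {ξ t : ℝ} (hξ : 0 < ξ) (ht : 0 < t) :
    ∫ v, dilatedSymbol k v ξ * dilatedSymbol k v t ∂scaleMeasure = kernelB k ξ t := by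
  rw [scaleMeasure, integral_withDensity_eq_integral_toReal_smul measurable_density (by simp)]
  have : ∫ v, (ENNReal.ofReal (v ^ 2)⁻¹).toReal •
      (dilatedSymbol k v ξ * dilatedSymbol k v t) ∂halfLine
      = ∫ v in Ioi (0 : ℝ), 2 * Real.sqrt (t * ξ) *
        (laguerreFun k (2 * v * ξ) * laguerreFun k (2 * v * t)) :=
    setIntegral_congr_fun measurableSet_Ioi fun v hv => smul_dilatedSymbol_mul k hξ ht hv
  rw [this, integral_const_mul, integral_laguerreFun_mul k (add_pos hξ ht), kernelB]
  ring

theorem legendre_one (n : ℕ) : legendre n 1 = 1 := by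
  rw [legendre_eq_sum, Finset.sum_range_succ', Finset.sum_eq_zero]
  · norm_num
  · intro m _
    simp

theorem kernelB_self (k : ℕ) {ξ : ℝ} (hξ : 0 < ξ) : kernelB k ξ ξ = 1 := by
  have h1 : 8 * ξ * ξ / (ξ + ξ) ^ 2 - 1 = 1 := by field_simp; ring
  rw [kernelB, h1, legendre_one, Real.sqrt_mul_self hξ.le]
  field_simp
  ring

/-- Uses `|ab| ≤ (a² + b²)/2` and the diagonal value `1`. This bound, uniform in `ξ` and `t`,
justifies integrating over `v` first; it also gives `|B_k| ≤ 1` with no estimate on Legendre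
polynomials. -/
theorem integral_abs_dilatedSymbol_mul_le (k : ℕ) {ξ t : ℝ} (hξ : 0 < ξ) (ht : 0 < t) :
    ∫ v, |dilatedSymbol k v ξ * dilatedSymbol k v t| ∂scaleMeasure ≤ 1 := by
  have h : ∫ v, |dilatedSymbol k v ξ * dilatedSymbol k v t| ∂scaleMeasure
      ≤ ∫ v, 1 / 2 * (dilatedSymbol k v ξ * dilatedSymbol k v ξ)
        + 1 / 2 * (dilatedSymbol k v t * dilatedSymbol k v t) ∂scaleMeasure := by
    refine integral_mono (integrable_dilatedSymbol_mul k hξ ht).abs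
      (((integrable_dilatedSymbol_mul k hξ hξ).const_mul _).add
        ((integrable_dilatedSymbol_mul k ht ht).const_mul _)) fun v => ?_
    simp only
    rw [abs_le]
    constructor <;> nlinarith [sq_nonneg (dilatedSymbol k v ξ + dilatedSymbol k v t),
      sq_nonneg (dilatedSymbol k v ξ - dilatedSymbol k v t)]
  rw [integral_add ((integrable_dilatedSymbol_mul k hξ hξ).const_mul _)
    ((integrable_dilatedSymbol_mul k ht ht).const_mul _), integral_const_mul, integral_const_mul,
    integral_dilatedSymbol_mul k hξ hξ, integral_dilatedSymbol_mul k ht ht, kernelB_self k hξ,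
    kernelB_self k ht] at h
  linarith

theorem abs_kernelB_le_one (k : ℕ) {ξ t : ℝ} (hξ : 0 < ξ) (ht : 0 < t) : |kernelB k ξ t| ≤ 1 := by
  rw [← integral_dilatedSymbol_mul k hξ ht]
  exact abs_integral_le_integral_abs.trans (integral_abs_dilatedSymbol_mul_le k hξ ht)

/-- Calderón's admissibility condition with constant exactly `1`, the source of the isometry. -/
theorem lintegral_dilatedSymbol_sq (k : ℕ) {ξ : ℝ} (hξ : 0 < ξ) :
    ∫⁻ v, ‖(dilatedSymbol k v ξ : ℂ)‖ₑ ^ 2 ∂scaleMeasure = 1 := by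
  have h := ofReal_integral_eq_lintegral_ofReal (integrable_dilatedSymbol_mul k hξ hξ)
    (Filter.Eventually.of_forall fun v => mul_self_nonneg _)
  rw [integral_dilatedSymbol_mul k hξ hξ, kernelB_self k hξ, ENNReal.ofReal_one] at h
  rw [h]
  refine lintegral_congr fun v => ?_
  rw [← ofReal_norm, ← ENNReal.ofReal_pow (norm_nonneg _), Complex.norm_real,
    Real.norm_eq_abs, sq_abs, sq]

theorem measurable_kernelB (k : ℕ) : Measurable fun z : ℝ × ℝ => kernelB k z.1 z.2 := by
  have := (contDiff_legendre k).continuous.measurable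
  unfold kernelB
  fun_prop

theorem contDiffOn_kernelB (k : ℕ) :
    ContDiffOn ℝ ∞ (fun z : ℝ × ℝ => kernelB k z.1 z.2) (Ioi 0 ×ˢ Ioi 0) := by
  rintro ⟨ξ, t⟩ ⟨hξ, ht⟩
  simp only [mem_Ioi] at hξ ht
  have h1 : t + ξ ≠ 0 := by positivity
  have h2 : t * ξ ≠ 0 := by positivity
  refine ContDiffAt.contDiffWithinAt ?_
  unfold kernelB
  refine ContDiffAt.mul (ContDiffAt.div (contDiffAt_const.mul (ContDiffAt.sqrt (by fun_prop) h2))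
    (by fun_prop) h1) ((contDiff_legendre k).contDiffAt.comp (ξ, t) ?_)
  have h3 : ((ξ, t).2 + (ξ, t).1) ^ 2 ≠ 0 := pow_ne_zero 2 h1
  have h4 : ContDiffAt ℝ ∞ (fun z : ℝ × ℝ => (z.2 + z.1) ^ 2) (ξ, t) := by fun_prop
  have h5 : ContDiffAt ℝ ∞ (fun z : ℝ × ℝ => 8 * z.2 * z.1) (ξ, t) := by fun_prop
  exact (h5.div h4 h3).sub contDiffAt_const

/-! ### The wavelet transform on the Fourier side -/

/-- Both sides are continuous in `h`, so it is enough to check Schwartz functions, where this is the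
definition of the distributional Fourier transform of `f`. -/
theorem integral_mul_fourier_Lp (f h : Lp ℂ 2 (volume : Measure ℝ)) :
    ∫ x, f x * (𝓕 h : Lp ℂ 2 (volume : Measure ℝ)) x
      = ∫ ξ, (𝓕 f : Lp ℂ 2 (volume : Measure ℝ)) ξ * h ξ := by
  have key : ∀ a b : Lp ℂ 2 (volume : Measure ℝ),
      (ContinuousLinearMap.mul ℂ ℂ).lpPairing volume 2 2 a b = ∫ x, a x * b x := fun a b => by
    rw [ContinuousLinearMap.lpPairing_eq_integral]; rfl
  rw [← key, ← key]
  refine DenseRange.induction_on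
    (p := fun h => (ContinuousLinearMap.mul ℂ ℂ).lpPairing volume 2 2 f (𝓕 h)
      = (ContinuousLinearMap.mul ℂ ℂ).lpPairing volume 2 2 (𝓕 f) h)
    (SchwartzMap.denseRange_toLpCLM (p := 2) ENNReal.ofNat_ne_top) h ?_ fun g => ?_
  · exact isClosed_eq (((ContinuousLinearMap.mul ℂ ℂ).lpPairing volume 2 2 f).continuous.comp
      (Lp.fourierTransformₗᵢ ℝ ℂ).continuous)
      ((ContinuousLinearMap.mul ℂ ℂ).lpPairing volume 2 2 (𝓕 f)).continuous
  · have h1 := congrArg (fun T : 𝓢'(ℝ, ℂ) => T g) (Lp.fourier_toTemperedDistribution_eq f)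
    simp only [TemperedDistribution.fourier_apply, Lp.toTemperedDistribution_apply] at h1
    rw [SchwartzMap.toLpCLM_apply, SchwartzMap.toLp_fourier_eq, key, key]
    refine Eq.trans (integral_congr_ae ?_) (h1.trans (integral_congr_ae ?_))
    · filter_upwards [(𝓕 g).coeFn_toLp 2 volume] with x hx
      rw [hx, smul_eq_mul, mul_comm]
    · filter_upwards [g.coeFn_toLp 2 volume] with x hx
      rw [hx, smul_eq_mul, mul_comm]

theorem integrable_waveletHat (k : ℕ) : Integrable (waveletHat k) := by
  have hL := continuous_laguerreFun k
  have hcont : Continuous fun ξ : ℝ => Real.sqrt (2 * ξ) * laguerreFun k (2 * ξ) := by fun_prop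
  unfold waveletHat
  rw [integrable_indicator_iff measurableSet_Ioi]
  refine (integrable_norm_iff (Complex.continuous_ofReal.comp hcont).aestronglyMeasurable).1 ?_
  -- Half of the decay `e^{-ξ}` is spent on absorbing the polynomial growth.
  refine integrable_of_isBigO_exp_neg (a := 0) (b := 1 / 2) (by norm_num) ?_ ?_
  · exact (Complex.continuous_ofReal.comp hcont).norm.continuousOn
  · have h0 : (fun ξ : ℝ => Real.sqrt (2 * ξ)) =O[Filter.atTop] fun ξ : ℝ => ξ := by
      refine Asymptotics.IsBigO.of_bound 1 ?_
      filter_upwards [Filter.eventually_ge_atTop 2] with ξ hξ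
      rw [one_mul, Real.norm_eq_abs, Real.norm_eq_abs, abs_of_nonneg (Real.sqrt_nonneg _),
        abs_of_nonneg (by linarith)]
      exact Real.sqrt_le_iff.2 ⟨by linarith, by nlinarith⟩
    have h2 : (fun ξ : ℝ => ξ * ξ ^ k) =O[Filter.atTop] fun ξ : ℝ => Real.exp (1 / 2 * ξ) := by
      simpa [pow_succ'] using
        (isLittleO_pow_exp_pos_mul_atTop (k + 1) (b := 1 / 2) (by norm_num)).isBigO
    have h3 := ((h0.mul (laguerre_isBigO k)).trans h2).mul
      (Asymptotics.isBigO_refl (fun ξ : ℝ => Real.exp (-ξ)) Filter.atTop)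
    refine (h3.norm_left).congr (fun ξ => ?_) fun ξ => ?_
    · rw [Function.comp_apply, Complex.norm_real]
      unfold laguerreFun
      congr 1
      have : -(2 * ξ) / 2 = -ξ := by ring
      rw [this]
      ring
    · rw [← Real.exp_add]
      congr 1
      ring

theorem dilatedSymbol_eq_waveletHat (k : ℕ) {v : ℝ} (hv : 0 < v) :
    (fun ξ => (dilatedSymbol k v ξ : ℂ)) = fun ξ => (Real.sqrt v : ℂ) * waveletHat k (v * ξ) :=
  funext fun ξ => (waveletHat_mul k hv ξ).symm

theorem continuous_dilatedSymbol_right (k : ℕ) (v : ℝ) : Continuous (dilatedSymbol k v) :=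
  (continuous_dilatedSymbol k).comp (by fun_prop : Continuous fun ξ : ℝ => (v, ξ))

theorem integrable_dilatedSymbol (k : ℕ) {v : ℝ} (hv : 0 < v) :
    Integrable fun ξ => (dilatedSymbol k v ξ : ℂ) := by
  rw [dilatedSymbol_eq_waveletHat k hv]
  exact ((integrable_waveletHat k).comp_mul_left' hv.ne').const_mul _

theorem memLp_dilatedSymbol (k : ℕ) {v : ℝ} (hv : 0 < v) :
    MemLp (fun ξ => (dilatedSymbol k v ξ : ℂ)) 2 volume := by
  refine (memLp_two_iff_integrable_sq_norm (Complex.continuous_ofReal.comp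
    (continuous_dilatedSymbol_right k v)).aestronglyMeasurable).2 ?_
  have h := (memLp_two_iff_integrable_sq_norm (memLp_waveletHat k).1).1 (memLp_waveletHat k)
  refine ((h.comp_mul_left' hv.ne').const_mul (‖(Real.sqrt v : ℂ)‖ ^ 2)).congr ?_
  filter_upwards with ξ
  rw [Function.comp_apply, ← waveletHat_mul k hv, norm_mul, mul_pow]

/-- The function `(u, v) ↦ ∫ ψ̂_{k,v}(ξ) φ(ξ) e^{2πiuξ} dξ` on `G`. -/
def synthesis (k : ℕ) (φ : ℝ → ℂ) (z : ℝ × ℝ) : ℂ :=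
  𝓕⁻ (fun ξ => (dilatedSymbol k z.2 ξ : ℂ) * φ ξ) z.1

theorem dilatedWavelet_ae_eq (k : ℕ) (u : ℝ) {v : ℝ} (hv : 0 < v) :
    (fun x => dilatedWavelet k v (u - x)) =ᵐ[volume]
      𝓕 (fun ξ => Real.fourierChar (u * ξ) • (dilatedSymbol k v ξ : ℂ)) := by
  have hq : Measure.QuasiMeasurePreserving (fun x : ℝ => (u - x) / v) := by
    have h1 : Measure.QuasiMeasurePreserving (fun x : ℝ => u - x) :=
      (Measure.measurePreserving_sub_left volume u).quasiMeasurePreserving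
    have h2 : Measure.QuasiMeasurePreserving (fun x : ℝ => v⁻¹ * x) := by
      refine ⟨by fun_prop, ?_⟩
      rw [Real.map_volume_mul_left (inv_ne_zero hv.ne')]
      exact Measure.smul_absolutelyContinuous
    have h3 : (fun x : ℝ => (u - x) / v) = (fun x => v⁻¹ * x) ∘ fun x => u - x :=
      funext fun x => div_eq_inv_mul _ _
    rw [h3]
    exact h2.comp h1
  have h := hq.ae_eq_comp (coeFn_fourierInv_toLp (integrable_waveletHat k) (memLp_waveletHat k))
  filter_upwards [h] with x hx
  have hx' : wavelet k ((u - x) / v) = 𝓕⁻ (waveletHat k) ((u - x) / v) := hx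
  rw [dilatedWavelet, hx', Real.fourierInv_eq, Real.fourier_eq]
  -- Rescaling the frequency by `v` turns the prefactor `v^{-1/2}` into the `v^{1/2}` of
  -- `dilatedSymbol`.
  have h3 := Measure.integral_comp_mul_left
    (fun y => Real.fourierChar (inner ℝ y ((u - x) / v)) • waveletHat k y) v
  rw [← integral_const_mul]
  rw [abs_of_pos (inv_pos.2 hv), ← inv_smul_eq_iff₀ (inv_ne_zero hv.ne'), inv_inv] at h3
  rw [integral_const_mul, ← h3, Complex.real_smul, ← mul_assoc, ← Complex.ofReal_mul,
    ← integral_const_mul]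
  refine integral_congr_ae (Filter.Eventually.of_forall fun ξ => ?_)
  have h4 : (Real.sqrt v)⁻¹ * v = Real.sqrt v := by
    field_simp; rw [Real.sq_sqrt hv.le]
  simp only [h4, Circle.smul_def, smul_eq_mul, ← waveletHat_mul k hv]
  have h5 : Real.fourierChar (inner ℝ (v * ξ) ((u - x) / v))
      = Real.fourierChar (-inner ℝ ξ x) * Real.fourierChar (u * ξ) := by
    rw [← AddChar.map_add_eq_mul]
    congr 1
    simp only [RCLike.inner_apply, conj_trivial]
    field_simp
    ring
  rw [h5, Circle.coe_mul]
  ring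

/-- The reflected, translated and dilated wavelet is the Fourier transform of a modulated symbol;
the multiplication formula shifts that transform onto `f`. -/
theorem waveletTransform_eq_synthesis (k : ℕ) (f : Lp ℂ 2 (volume : Measure ℝ)) (z : ℝ × ℝ)
    (hv : 0 < z.2) :
    waveletTransform k f z = synthesis k (𝓕 f : Lp ℂ 2 (volume : Measure ℝ)) z := by
  obtain ⟨u, v⟩ := z
  have hcont : Continuous fun ξ : ℝ => Real.fourierChar (u * ξ) :=
    Real.continuous_fourierChar.comp (by fun_prop)
  have hi : Integrable fun ξ => Real.fourierChar (u * ξ) • (dilatedSymbol k v ξ : ℂ) := by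
    refine (integrable_dilatedSymbol k hv).mono
      (hcont.smul (Complex.continuous_ofReal.comp
        (continuous_dilatedSymbol_right k v))).aestronglyMeasurable ?_
    filter_upwards with ξ
    rw [Circle.norm_smul]
  have h2 : MemLp (fun ξ => Real.fourierChar (u * ξ) • (dilatedSymbol k v ξ : ℂ)) 2 volume := by
    refine (memLp_dilatedSymbol k hv).mono hi.1 ?_
    filter_upwards with ξ
    rw [Circle.norm_smul]
  have h3 := integral_mul_fourier_Lp f (h2.toLp _)
  calc waveletTransform k f (u, v)
      = ∫ x, f x * (𝓕 (h2.toLp _) : Lp ℂ 2 (volume : Measure ℝ)) x := by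
        refine integral_congr_ae ?_
        filter_upwards [dilatedWavelet_ae_eq k u hv, coeFn_fourier_toLp hi h2] with x h4 h5
        rw [h5]
        exact congrArg _ h4
    _ = _ := h3
    _ = _ := by
        rw [synthesis, Real.fourierInv_eq]
        refine integral_congr_ae ?_
        filter_upwards [h2.coeFn_toLp] with ξ h4
        rw [h4]
        simp only [Circle.smul_def, smul_eq_mul, RCLike.inner_apply, conj_trivial]
        ring

/-! ### The isometry of `L_2(ℝ_+)` onto the wavelet subspace -/

theorem ae_haarG_pos : ∀ᵐ z ∂haarG, 0 < z.2 :=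
  Measure.quasiMeasurePreserving_snd.ae ae_scaleMeasure_pos

theorem synthesis_congr (k : ℕ) {φ γ : ℝ → ℂ} (h : φ =ᵐ[halfLine] γ) {z : ℝ × ℝ} (hz : 0 < z.2) :
    synthesis k φ z = synthesis k γ z := by
  rw [synthesis, synthesis, Real.fourierInv_eq, Real.fourierInv_eq]
  refine integral_congr_ae ?_
  filter_upwards [(ae_restrict_iff' measurableSet_Ioi).1 h] with ξ hξ
  rcases le_or_gt ξ 0 with h0 | h0
  · rw [dilatedSymbol_of_nonpos k hz h0]; simp
  · rw [hξ h0]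

theorem dilatedSymbol_mul_eq_indicator (k : ℕ) {v : ℝ} (hv : 0 < v) (φ : ℝ → ℂ) :
    (fun ξ => (dilatedSymbol k v ξ : ℂ) * φ ξ)
      = (Ioi 0).indicator fun ξ => (dilatedSymbol k v ξ : ℂ) * φ ξ := by
  funext ξ
  rcases le_or_gt ξ 0 with h0 | h0
  · rw [dilatedSymbol_of_nonpos k hv h0, indicator_of_notMem (by simpa using h0)]; simp
  · rw [indicator_of_mem (mem_Ioi.2 h0)]

theorem integrable_dilatedSymbol_mul_of_memLp (k : ℕ) {v : ℝ} (hv : 0 < v) {φ : ℝ → ℂ}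
    (hφ : MemLp φ 2 halfLine) : Integrable fun ξ => (dilatedSymbol k v ξ : ℂ) * φ ξ := by
  rw [dilatedSymbol_mul_eq_indicator k hv, integrable_indicator_iff measurableSet_Ioi]
  exact ((memLp_dilatedSymbol k hv).restrict _).integrable_mul hφ

theorem stronglyMeasurable_synthesis (k : ℕ) {φ : ℝ → ℂ} (hφ : StronglyMeasurable φ) :
    StronglyMeasurable (synthesis k φ) := by
  unfold synthesis
  simp only [Real.fourierInv_eq]
  refine StronglyMeasurable.integral_prod_right' (f := fun p : (ℝ × ℝ) × ℝ =>
    Real.fourierChar (inner ℝ p.2 p.1.1) • ((dilatedSymbol k p.1.2 p.2 : ℂ) * φ p.2)) ?_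
  have h1 : Continuous fun p : (ℝ × ℝ) × ℝ => Real.fourierChar (inner ℝ p.2 p.1.1) :=
    Real.continuous_fourierChar.comp (by fun_prop)
  have h2 : Continuous fun p : (ℝ × ℝ) × ℝ => (dilatedSymbol k p.1.2 p.2 : ℂ) :=
    Complex.continuous_ofReal.comp ((continuous_dilatedSymbol k).comp (by fun_prop :
      Continuous fun p : (ℝ × ℝ) × ℝ => (p.1.2, p.2)))
  exact h1.stronglyMeasurable.smul (h2.stronglyMeasurable.mul
    (hφ.comp_measurable measurable_snd))

/-- Plancherel in `u` at fixed `v`, then Tonelli and the admissibility condition. -/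
theorem lintegral_enorm_synthesis_sq (k : ℕ) {φ : ℝ → ℂ} (hφ : StronglyMeasurable φ)
    (h2 : MemLp φ 2 halfLine) :
    ∫⁻ z, ‖synthesis k φ z‖ₑ ^ 2 ∂haarG = ∫⁻ ξ, ‖φ ξ‖ₑ ^ 2 ∂halfLine := by
  have hqm : Measurable fun p : ℝ × ℝ => ‖(dilatedSymbol k p.1 p.2 : ℂ) * φ p.2‖ₑ ^ 2 := by
    have := (Complex.continuous_ofReal.comp (continuous_dilatedSymbol k)).measurable
    have h3 : Measurable fun p : ℝ × ℝ => φ p.2 := hφ.measurable.comp measurable_snd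
    exact ((this.mul h3).enorm.pow_const 2)
  have hT : ∫⁻ v, ∫⁻ ξ, ‖(dilatedSymbol k v ξ : ℂ) * φ ξ‖ₑ ^ 2 ∂halfLine ∂scaleMeasure
      = ∫⁻ ξ, ‖φ ξ‖ₑ ^ 2 ∂halfLine := by
    rw [lintegral_lintegral_swap hqm.aemeasurable]
    refine lintegral_congr_ae ?_
    filter_upwards [ae_restrict_mem measurableSet_Ioi] with ξ hξ
    simp only [enorm_mul, mul_pow]
    rw [lintegral_mul_const _ (by
      have := (Complex.continuous_ofReal.comp (continuous_dilatedSymbol k)).measurable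
      exact ((this.comp (measurable_id.prodMk measurable_const)).enorm.pow_const 2)),
      lintegral_dilatedSymbol_sq k hξ, one_mul]
  have hfin : ∫⁻ ξ, ‖φ ξ‖ₑ ^ 2 ∂halfLine < ⊤ := by
    have := h2.2
    rw [eLpNorm_lt_top_iff_lintegral_rpow_enorm_lt_top two_ne_zero ENNReal.ofNat_ne_top] at this
    simpa using this
  have hv : ∀ᵐ v ∂scaleMeasure, ∫⁻ u, ‖synthesis k φ (u, v)‖ₑ ^ 2
      = ∫⁻ ξ, ‖(dilatedSymbol k v ξ : ℂ) * φ ξ‖ₑ ^ 2 ∂halfLine := by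
    -- Finiteness of the double integral makes almost every slice square integrable, as Plancherel
    -- requires.
    have hlt := ae_lt_top' (hqm.lintegral_prod_right').aemeasurable (hT.trans_lt hfin).ne
    filter_upwards [ae_scaleMeasure_pos, hlt] with v hv hlt
    have e : ∫⁻ ξ, ‖(dilatedSymbol k v ξ : ℂ) * φ ξ‖ₑ ^ 2
        = ∫⁻ ξ, ‖(dilatedSymbol k v ξ : ℂ) * φ ξ‖ₑ ^ 2 ∂halfLine := by
      rw [halfLine, ← lintegral_indicator measurableSet_Ioi]
      refine lintegral_congr fun ξ => ?_
      rcases le_or_gt ξ 0 with h0 | h0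
      · rw [dilatedSymbol_of_nonpos k hv h0, indicator_of_notMem (by simpa using h0)]; simp
      · rw [indicator_of_mem (mem_Ioi.2 h0)]
    have hi := integrable_dilatedSymbol_mul_of_memLp k hv h2
    refine (lintegral_enorm_fourierInv_sq hi ⟨hi.1, ?_⟩).trans e
    rw [eLpNorm_lt_top_iff_lintegral_rpow_enorm_lt_top two_ne_zero ENNReal.ofNat_ne_top]
    simpa using e.trans_lt hlt
  rw [haarG_eq_prod, lintegral_prod_symm _
    ((stronglyMeasurable_synthesis k hφ).measurable.enorm.pow_const 2).aemeasurable,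
    lintegral_congr_ae hv, hT]

theorem eLpNorm_synthesis (k : ℕ) {φ : ℝ → ℂ} (hφ : StronglyMeasurable φ)
    (h2 : MemLp φ 2 halfLine) :
    eLpNorm (synthesis k φ) 2 haarG = eLpNorm φ 2 halfLine := by
  simp only [eLpNorm_eq_lintegral_rpow_enorm_toReal two_ne_zero ENNReal.ofNat_ne_top,
    ENNReal.toReal_ofNat, ENNReal.rpow_ofNat, lintegral_enorm_synthesis_sq k hφ h2]

theorem memLp_synthesis (k : ℕ) (φ : Lp ℂ 2 halfLine) : MemLp (synthesis k φ) 2 haarG :=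
  ⟨(stronglyMeasurable_synthesis k (Lp.stronglyMeasurable φ)).aestronglyMeasurable, by
    rw [eLpNorm_synthesis k (Lp.stronglyMeasurable φ) (Lp.memLp φ)]; exact Lp.eLpNorm_lt_top φ⟩

/-- `synthesis` as a linear isometry of `L_2(ℝ_+)` into `L_2(G, dν)`. -/
def synthesisₗᵢ (k : ℕ) : Lp ℂ 2 halfLine →ₗᵢ[ℂ] Lp ℂ 2 haarG where
  toFun φ := (memLp_synthesis k φ).toLp _
  map_add' φ γ := by
    rw [← MemLp.toLp_add, MemLp.toLp_eq_toLp_iff]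
    filter_upwards [ae_haarG_pos] with z hz
    rw [synthesis_congr k (Lp.coeFn_add φ γ) hz, Pi.add_apply]
    simp only [synthesis, Pi.add_apply, mul_add]
    exact congrFun (VectorFourier.fourierIntegral_add Real.continuous_fourierChar
      (L := -innerₗ ℝ) continuous_inner.neg
      (integrable_dilatedSymbol_mul_of_memLp k hz (Lp.memLp φ))
      (integrable_dilatedSymbol_mul_of_memLp k hz (Lp.memLp γ))) z.1
  map_smul' c φ := by
    rw [RingHom.id_apply, ← MemLp.toLp_const_smul, MemLp.toLp_eq_toLp_iff]
    filter_upwards [ae_haarG_pos] with z hz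
    rw [synthesis_congr k (Lp.coeFn_smul c φ) hz, Pi.smul_apply]
    simp only [synthesis, Real.fourierInv_eq, Pi.smul_apply, ← integral_smul]
    refine integral_congr_ae (Filter.Eventually.of_forall fun ξ => ?_)
    simp only [Circle.smul_def, smul_eq_mul]
    ring
  norm_map' φ := by
    rw [LinearMap.coe_mk, AddHom.coe_mk, Lp.norm_toLp,
      eLpNorm_synthesis k (Lp.stronglyMeasurable φ) (Lp.memLp φ), Lp.norm_def]

theorem coeFn_synthesisₗᵢ (k : ℕ) (φ : Lp ℂ 2 halfLine) :
    synthesisₗᵢ k φ =ᵐ[haarG] synthesis k φ :=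
  (memLp_synthesis k φ).coeFn_toLp

/-- A preimage in the Hardy space is the inverse Fourier transform of `φ` extended by zero;
conversely `φ` is `𝓕 f` restricted to the half-line, because the symbol kills all other frequencies.
-/
theorem range_synthesisₗᵢ (k : ℕ) : (synthesisₗᵢ k).range = waveletSpace k := by
  ext F
  constructor
  · rintro ⟨φ, rfl⟩
    have hg : MemLp ((Ioi (0 : ℝ)).indicator φ) 2 volume :=
      (memLp_indicator_iff_restrict measurableSet_Ioi).2 (Lp.memLp φ)
    refine ⟨𝓕⁻ (hg.toLp _), ?_, ?_⟩
    · change ∀ᵐ ξ, ξ < 0 → (𝓕 (𝓕⁻ (hg.toLp _)) : Lp ℂ 2 (volume : Measure ℝ)) ξ = 0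
      rw [FourierTransform.fourier_fourierInv_eq]
      filter_upwards [hg.coeFn_toLp] with ξ h1 h2
      rw [h1, indicator_of_notMem (by simpa using h2.le)]
    · filter_upwards [coeFn_synthesisₗᵢ k φ, ae_haarG_pos] with z h1 hz
      rw [waveletTransform_eq_synthesis k _ z hz, FourierTransform.fourier_fourierInv_eq]
      refine h1.trans (synthesis_congr k ?_ hz)
      filter_upwards [ae_restrict_of_ae hg.coeFn_toLp, ae_restrict_mem measurableSet_Ioi]
        with ξ h2 h3
      rw [h2, indicator_of_mem h3]
  · rintro ⟨f, -, hf⟩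
    have hg : MemLp (𝓕 f : Lp ℂ 2 (volume : Measure ℝ)) 2 halfLine := (Lp.memLp _).restrict _
    refine ⟨hg.toLp _, Lp.ext ?_⟩
    filter_upwards [coeFn_synthesisₗᵢ k (hg.toLp _), hf, ae_haarG_pos] with z h1 h2 hz
    rw [h2, waveletTransform_eq_synthesis k _ z hz]
    exact h1.trans (synthesis_congr k hg.coeFn_toLp hz)

instance hasOrthogonalProjection_waveletSpace (k : ℕ) :
    (waveletSpace k).HasOrthogonalProjection := by
  rw [← range_synthesisₗᵢ]
  have : CompleteSpace (synthesisₗᵢ k).range :=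
    (synthesisₗᵢ k).isometry.isUniformInducing.isComplete_range.completeSpace_coe
  infer_instance

/-- The unitary operator of `A_k` onto `L_2(ℝ_+)`. -/
def bargmannₗᵢ (k : ℕ) : waveletSpace k ≃ₗᵢ[ℂ] Lp ℂ 2 halfLine :=
  ((synthesisₗᵢ k).equivRange.trans
    (LinearIsometryEquiv.ofEq _ _ (range_synthesisₗᵢ k))).symm

theorem coe_bargmannₗᵢ_symm (k : ℕ) (φ : Lp ℂ 2 halfLine) :
    ((bargmannₗᵢ k).symm φ : Lp ℂ 2 haarG) = synthesisₗᵢ k φ := rfl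

/-! ### The compression of a horizontal symbol to `L_2(ℝ_+)` -/

/-- The operator on `L_2(ℝ_+)` unitarily equivalent to the Toeplitz operator with symbol `a`. -/
def halfLineOp (k : ℕ) {a : ℝ × ℝ → ℂ} (ha : MemLp a ⊤ haarG) :
    Lp ℂ 2 halfLine →L[ℂ] Lp ℂ 2 halfLine :=
  (bargmannₗᵢ k).toContinuousLinearEquiv.toContinuousLinearMap ∘L toeplitzOp k ha ∘L
    (bargmannₗᵢ k).symm.toContinuousLinearEquiv.toContinuousLinearMap

theorem halfLineOp_apply (k : ℕ) {a : ℝ × ℝ → ℂ} (ha : MemLp a ⊤ haarG) (F : Lp ℂ 2 halfLine) :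
    halfLineOp k ha F = bargmannₗᵢ k (toeplitzOp k ha ((bargmannₗᵢ k).symm F)) := rfl

theorem bargmannₗᵢ_toeplitzOp (k : ℕ) {a : ℝ × ℝ → ℂ} (ha : MemLp a ⊤ haarG)
    (F : waveletSpace k) :
    bargmannₗᵢ k (toeplitzOp k ha F) = halfLineOp k ha (bargmannₗᵢ k F) := by
  rw [halfLineOp_apply, LinearIsometryEquiv.symm_apply_apply]

/-- The projection drops out because the left vector already lies in `A_k`, leaving an explicit
integral over `G`. -/
theorem inner_halfLineOp (k : ℕ) {a : ℝ × ℝ → ℂ} (ha : MemLp a ⊤ haarG)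
    (G F : Lp ℂ 2 halfLine) :
    inner ℂ G (halfLineOp k ha F) = inner ℂ (synthesisₗᵢ k G) (mulOp ha (synthesisₗᵢ k F)) := by
  have h := (bargmannₗᵢ k).inner_map_map ((bargmannₗᵢ k).symm G)
    (toeplitzOp k ha ((bargmannₗᵢ k).symm F))
  rw [LinearIsometryEquiv.apply_symm_apply] at h
  rw [halfLineOp_apply, h, ← coe_bargmannₗᵢ_symm, ← coe_bargmannₗᵢ_symm]
  exact Submodule.inner_orthogonalProjectionOnto_eq_of_mem_left _ _

theorem coeFn_mulOp {a : ℝ × ℝ → ℂ} (ha : MemLp a ⊤ haarG) (F : Lp ℂ 2 haarG) :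
    mulOp ha F =ᵐ[haarG] fun z => a z * F z := by
  filter_upwards [(ContinuousLinearMap.mul ℂ ℂ).coeFn_holder (r := 2) (ha.toLp a) F,
    ha.coeFn_toLp] with z h1 h2
  rw [← h2]
  exact h1

theorem integral_shear {μ : Measure ℝ} [SFinite μ] {f : ℝ × ℝ → ℂ}
    (hf : Integrable f (μ.prod volume)) :
    ∫ t, (∫ ξ, f (t, ξ)) ∂μ = ∫ s, ∫ t, f (t, t + s) ∂μ := by
  have h1 : Integrable (Function.uncurry fun t s : ℝ => f (t, t + s)) (μ.prod volume) :=
    (measurePreserving_prod_add μ volume).integrable_comp_of_integrable hf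
  rw [← integral_integral_swap h1]
  refine integral_congr_ae (Filter.Eventually.of_forall fun t => ?_)
  exact (integral_add_left_eq_self (μ := volume) (fun ξ => f (t, ξ)) t).symm

theorem ae_prod_fst_pos : ∀ᵐ p ∂halfLine.prod (volume : Measure ℝ), 0 < p.1 :=
  Measure.quasiMeasurePreserving_fst.ae (ae_restrict_mem measurableSet_Ioi)

theorem integrable_kernelB_mul (k : ℕ) {a c : ℝ → ℂ} (ha : Integrable a)
    (ha0 : ∀ ξ ≤ 0, a ξ = 0) (hc : Integrable c halfLine) :
    Integrable (fun p : ℝ × ℝ => (kernelB k p.2 p.1 : ℂ) * (c p.1 * a p.2))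
      (halfLine.prod volume) := by
  have h := hc.mul_prod ha
  refine h.mono (AEStronglyMeasurable.mul ?_ h.1) ?_
  · exact (Complex.measurable_ofReal.comp
      ((measurable_kernelB k).comp measurable_swap)).aestronglyMeasurable
  · filter_upwards [ae_prod_fst_pos] with p hp
    rcases le_or_gt p.2 0 with h0 | h0
    · simp [ha0 _ h0]
    · rw [norm_mul, Complex.norm_real, Real.norm_eq_abs]
      exact mul_le_of_le_one_left (norm_nonneg _) (abs_kernelB_le_one k h0 hp)

/-- Fubini with the `v`-integral taken first, where the overlap formula applies. Absolute
integrability follows from `integral_abs_dilatedSymbol_mul_le`. -/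
theorem integral_dilatedSymbol_mul_integral (k : ℕ) {a c : ℝ → ℂ} (ha : Integrable a)
    (ha0 : ∀ ξ ≤ 0, a ξ = 0) (hc : Integrable c halfLine) :
    ∫ v, (∫ ξ, (dilatedSymbol k v ξ : ℂ) * a ξ) *
        (∫ t, (dilatedSymbol k v t : ℂ) * c t ∂halfLine) ∂scaleMeasure
      = ∫ t, (∫ ξ, (kernelB k ξ t : ℂ) * (c t * a ξ)) ∂halfLine := by
  have hac := hc.mul_prod ha
  have hq : Continuous fun w : ℝ × (ℝ × ℝ) =>
      ((dilatedSymbol k w.1 w.2.1 * dilatedSymbol k w.1 w.2.2 : ℝ) : ℂ) :=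
    Complex.continuous_ofReal.comp
      (((continuous_dilatedSymbol k).comp (by fun_prop :
        Continuous fun w : ℝ × (ℝ × ℝ) => (w.1, w.2.1))).mul
      ((continuous_dilatedSymbol k).comp (by fun_prop :
        Continuous fun w : ℝ × (ℝ × ℝ) => (w.1, w.2.2))))
  have hint : Integrable (Function.uncurry fun (v : ℝ) (p : ℝ × ℝ) =>
      ((dilatedSymbol k v p.1 * dilatedSymbol k v p.2 : ℝ) : ℂ) * (c p.1 * a p.2))
      (scaleMeasure.prod (halfLine.prod volume)) := by
    have hac' : AEStronglyMeasurable (fun w : ℝ × (ℝ × ℝ) => c w.2.1 * a w.2.2)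
        (scaleMeasure.prod (halfLine.prod volume)) :=
      AEStronglyMeasurable.comp_snd (f := fun p : ℝ × ℝ => c p.1 * a p.2) hac.1
    have hm := hq.aestronglyMeasurable.mul hac'
    refine (integrable_prod_iff' hm).2 ⟨?_, hac.mono hm.norm.prod_swap.integral_prod_right' ?_⟩
    · filter_upwards [ae_prod_fst_pos] with p hp
      rcases le_or_gt p.2 0 with h0 | h0
      · simp [ha0 _ h0]
      · have h : Integrable (fun v => ((dilatedSymbol k v p.1 * dilatedSymbol k v p.2 : ℝ) : ℂ))
            scaleMeasure := (integrable_dilatedSymbol_mul k hp h0).ofReal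
        exact h.mul_const (c p.1 * a p.2)
    · filter_upwards [ae_prod_fst_pos] with p hp
      rcases le_or_gt p.2 0 with h0 | h0
      · simp [ha0 _ h0]
      · simp only [Pi.mul_apply, norm_mul _ (c p.1 * a p.2), Complex.norm_real,
          Real.norm_eq_abs, integral_mul_const]
        rw [abs_mul, abs_of_nonneg (norm_nonneg (c p.1 * a p.2)),
          abs_of_nonneg (integral_nonneg fun _ => abs_nonneg _)]
        exact mul_le_of_le_one_left (norm_nonneg _) (integral_abs_dilatedSymbol_mul_le k hp h0)
  calc _ = ∫ v, ∫ p, ((dilatedSymbol k v p.1 * dilatedSymbol k v p.2 : ℝ) : ℂ) *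
          (c p.1 * a p.2) ∂(halfLine.prod volume) ∂scaleMeasure := by
        refine integral_congr_ae (Filter.Eventually.of_forall fun v => ?_)
        simp only
        rw [mul_comm, ← integral_prod_mul]
        refine integral_congr_ae (Filter.Eventually.of_forall fun p => ?_)
        push_cast
        ring
    _ = ∫ p, (kernelB k p.2 p.1 : ℂ) * (c p.1 * a p.2) ∂(halfLine.prod volume) := by
        rw [integral_integral_swap hint]
        refine integral_congr_ae ?_
        filter_upwards [ae_prod_fst_pos] with p hp
        rcases le_or_gt p.2 0 with h0 | h0
        · simp [ha0 _ h0]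
        · rw [integral_mul_const, integral_complex_ofReal, ← integral_dilatedSymbol_mul k h0 hp]
          simp only [mul_comm]
    _ = _ := integral_prod _ (integrable_kernelB_mul k ha ha0 hc)

/-! ### The test function attached to a pair of test functions -/

/-- The kernel is known to be smooth only on the open quadrant; off the product of the closed
supports, which lies inside it, the product vanishes locally. -/
theorem contDiff_kernelB_mul (k : ℕ) {f g : ℝ → ℂ} (hf : ContDiff ℝ ∞ f)
    (hf0 : tsupport f ⊆ Ioi 0) (hg : ContDiff ℝ ∞ g) (hg0 : tsupport g ⊆ Ioi 0) :
    ContDiff ℝ ∞ fun p : ℝ × ℝ => (kernelB k p.1 p.2 : ℂ) * f p.2 * g p.1 := by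
  rw [contDiff_iff_contDiffAt]
  rintro ⟨ξ, t⟩
  by_cases ht : t ∈ tsupport f
  · by_cases hξ : ξ ∈ tsupport g
    · have h1 : ContDiffAt ℝ ∞ (fun p : ℝ × ℝ => kernelB k p.1 p.2) (ξ, t) :=
        (contDiffOn_kernelB k).contDiffAt
          ((isOpen_Ioi.prod isOpen_Ioi).mem_nhds ⟨hg0 hξ, hf0 ht⟩)
      have h2 : ContDiffAt ℝ ∞ (fun p : ℝ × ℝ => (kernelB k p.1 p.2 : ℂ)) (ξ, t) :=
        Complex.ofRealCLM.contDiff.contDiffAt.comp (ξ, t) h1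
      exact (h2.mul (hf.comp contDiff_snd).contDiffAt).mul (hg.comp contDiff_fst).contDiffAt
    · refine (contDiffAt_const (c := (0 : ℂ))).congr_of_eventuallyEq ?_
      have : ∀ᶠ p : ℝ × ℝ in nhds (ξ, t), p.1 ∉ tsupport g :=
        ((isClosed_tsupport g).preimage continuous_fst).isOpen_compl.mem_nhds hξ
      filter_upwards [this] with p hp
      rw [image_eq_zero_of_notMem_tsupport hp, mul_zero]
  · refine (contDiffAt_const (c := (0 : ℂ))).congr_of_eventuallyEq ?_
    have : ∀ᶠ p : ℝ × ℝ in nhds (ξ, t), p.2 ∉ tsupport f :=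
      ((isClosed_tsupport f).preimage continuous_snd).isOpen_compl.mem_nhds ht
    filter_upwards [this] with p hp
    rw [image_eq_zero_of_notMem_tsupport hp, mul_zero, zero_mul]

/-- The function `Φ_{f,g}(s) = ∫ B_k(t + s, t) f(t) g(t + s) dt`. -/
def testPairing (k : ℕ) (f g : ℝ → ℂ) (s : ℝ) : ℂ :=
  ∫ t, (kernelB k (t + s) t : ℂ) * f t * g (t + s) ∂halfLine

theorem setIntegral_halfLine_eq {f : ℝ → ℂ} (hf : ∀ t ≤ 0, f t = 0) :
    ∫ t, f t ∂halfLine = ∫ t, f t :=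
  setIntegral_eq_integral_of_forall_compl_eq_zero fun t ht => hf t (not_lt.1 ht)

theorem eq_zero_of_tsupport_subset_Ioi {f : ℝ → ℂ} (hf0 : tsupport f ⊆ Ioi 0) :
    ∀ t ≤ 0, f t = 0 := fun _ ht =>
  image_eq_zero_of_notMem_tsupport fun h => not_lt.2 ht (hf0 h)

theorem contDiff_testPairing (k : ℕ) {f g : ℝ → ℂ} (hf : ContDiff ℝ ∞ f)
    (hfc : HasCompactSupport f) (hf0 : tsupport f ⊆ Ioi 0) (hg : ContDiff ℝ ∞ g)
    (hg0 : tsupport g ⊆ Ioi 0) : ContDiff ℝ ∞ (testPairing k f g) := by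
  -- With this reflection the pairing at `s` is the convolution of the constant `1` with `G s`,
  -- evaluated at `0`. Smoothness then follows from the theorem on convolutions with a parameter.
  let G : ℝ → ℝ → ℂ := fun s y => (kernelB k (s - y) (-y) : ℂ) * f (-y) * g (s - y)
  have hp : ContDiff ℝ ∞ fun p : ℝ × ℝ => (p.1 - p.2, -p.2) := by fun_prop
  have hG : ContDiff ℝ ∞ fun p : ℝ × ℝ => G p.1 p.2 :=
    ContDiff.comp (f := fun p : ℝ × ℝ => (p.1 - p.2, -p.2))
      (contDiff_kernelB_mul k hf hf0 hg hg0) hp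
  have hk : IsCompact (-tsupport f) := IsCompact.neg hfc
  have hG0 : ∀ p x, p ∈ (univ : Set ℝ) → x ∉ -tsupport f → G p x = 0 := fun p x _ hx => by
    have : f (-x) = 0 := image_eq_zero_of_notMem_tsupport (by simpa using hx)
    simp only [G, this, mul_zero, zero_mul]
  have h1 : LocallyIntegrable (fun _ : ℝ => (1 : ℂ)) volume := locallyIntegrable_const _
  have hG' : ContDiffOn ℝ ((⊤ : ℕ∞) : WithTop ℕ∞) (Function.HasUncurry.uncurry G)
      (univ ×ˢ univ) := hG.contDiffOn
  have h : ContDiffOn ℝ ((⊤ : ℕ∞) : WithTop ℕ∞) (fun q : ℝ × ℝ =>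
      convolution (fun _ : ℝ => (1 : ℂ)) (G q.1) (ContinuousLinearMap.mul ℝ ℂ) volume q.2)
      (univ ×ˢ univ) :=
    contDiffOn_convolution_right_with_param _ isOpen_univ hk hG0 h1 hG'
  rw [univ_prod_univ, contDiffOn_univ] at h
  have h2 := h.comp (by fun_prop : ContDiff ℝ ∞ fun s : ℝ => (s, (0 : ℝ)))
  convert h2 using 1
  funext s
  rw [testPairing, setIntegral_halfLine_eq fun t ht => by
    rw [eq_zero_of_tsupport_subset_Ioi hf0 t ht, mul_zero, zero_mul]]
  simp only [Function.comp_apply, convolution, G, ContinuousLinearMap.mul_apply', one_mul,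
    zero_sub, neg_neg, sub_neg_eq_add, add_comm s]

theorem hasCompactSupport_testPairing (k : ℕ) {f g : ℝ → ℂ} (hfc : HasCompactSupport f)
    (hgc : HasCompactSupport g) : HasCompactSupport (testPairing k f g) := by
  -- The support lies in the difference set `supp g - supp f`.
  refine HasCompactSupport.intro ((IsCompact.prod hgc hfc).image continuous_sub) fun s hs => ?_
  rw [testPairing, ← integral_zero ℝ ℂ (μ := halfLine)]
  congr 1
  funext t
  by_cases ht : t ∈ tsupport f
  · have : t + s ∉ tsupport g := fun h => hs ⟨(t + s, t), ⟨h, ht⟩, by simp⟩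
    rw [image_eq_zero_of_notMem_tsupport this, mul_zero]
  · rw [image_eq_zero_of_notMem_tsupport ht, mul_zero, zero_mul]

/-- `testPairing` as a Schwartz function. -/
def testPairingSchwartz (k : ℕ) {f g : ℝ → ℂ} (hf : ContDiff ℝ ∞ f)
    (hfc : HasCompactSupport f) (hf0 : tsupport f ⊆ Ioi 0) (hg : ContDiff ℝ ∞ g)
    (hgc : HasCompactSupport g) (hg0 : tsupport g ⊆ Ioi 0) : 𝓢(ℝ, ℂ) :=
  (hasCompactSupport_testPairing k hfc hgc).toSchwartzMap
    (contDiff_testPairing k hf hfc hf0 hg hg0)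

/-- Absorb the characters `e^{-2πiuξ}` and `e^{2πiut}` into `g` and `f`, integrate out `v`, and
shear by `ξ = t + s`: the characters combine to `e^{-2πius}`. -/
theorem integral_fourier_mul_synthesis (k : ℕ) {f g : ℝ → ℂ} (hf : Integrable f)
    (hf0 : ∀ t ≤ 0, f t = 0) (hg : Integrable g) (hg0 : ∀ t ≤ 0, g t = 0) (u : ℝ) :
    ∫ v, 𝓕 (fun ξ => (dilatedSymbol k v ξ : ℂ) * g ξ) u * synthesis k f (u, v) ∂scaleMeasure
      = 𝓕 (testPairing k f g) u := by
  have hc1 : Continuous fun ξ : ℝ => Real.fourierChar (-(u * ξ)) :=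
    Real.continuous_fourierChar.comp (by fun_prop)
  have hc2 : Continuous fun ξ : ℝ => Real.fourierChar (u * ξ) :=
    Real.continuous_fourierChar.comp (by fun_prop)
  have hi : ∀ {h : ℝ → ℂ} {χ : ℝ → Circle}, Continuous χ → Integrable h →
      Integrable fun ξ => χ ξ • h ξ := fun hχ hh =>
    hh.mono (hχ.aestronglyMeasurable.smul hh.1) (by
      filter_upwards with ξ
      rw [Circle.norm_smul])
  have ha := hi hc1 hg
  have hc := (hi hc2 hf).mono_measure (Measure.restrict_le_self (s := Ioi 0))
  have ha0 : ∀ ξ ≤ 0, Real.fourierChar (-(u * ξ)) • g ξ = 0 := fun ξ h => by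
    rw [hg0 ξ h, smul_zero]
  have h1 := integral_dilatedSymbol_mul_integral k ha ha0 hc
  have h2 := integral_shear (integrable_kernelB_mul k ha ha0 hc)
  refine Eq.trans ?_ (h1.trans (h2.trans ?_))
  · refine integral_congr_ae (Filter.Eventually.of_forall fun v => ?_)
    simp only
    rw [Real.fourier_eq, synthesis, Real.fourierInv_eq, setIntegral_halfLine_eq fun t h => by
      rw [hf0 t h, smul_zero, mul_zero]]
    congr 2 <;> funext ξ <;>
    simp only [Circle.smul_def, smul_eq_mul, RCLike.inner_apply, conj_trivial] <;> ring
  · rw [Real.fourier_eq]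
    congr 1
    funext s
    rw [testPairing, Circle.smul_def, smul_eq_mul, ← integral_const_mul]
    congr 1
    funext t
    have h5 : Real.fourierChar (-inner ℝ s u)
        = Real.fourierChar (u * t) * Real.fourierChar (-(u * (t + s))) := by
      rw [← AddChar.map_add_eq_mul]
      congr 1
      simp only [RCLike.inner_apply, conj_trivial]
      ring
    simp only [h5, Circle.smul_def, smul_eq_mul, Circle.coe_mul]
    ring

theorem conj_synthesis_conj (k : ℕ) (g : ℝ → ℂ) (u v : ℝ) :
    starRingEnd ℂ (synthesis k (fun ξ => starRingEnd ℂ (g ξ)) (u, v))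
      = 𝓕 (fun ξ => (dilatedSymbol k v ξ : ℂ) * g ξ) u := by
  rw [synthesis, Real.fourierInv_eq, Real.fourier_eq, ← integral_conj]
  congr 1
  funext ξ
  simp only [Circle.smul_def, smul_eq_mul, map_mul, Complex.conj_ofReal, Complex.conj_conj,
    ← Circle.coe_inv_eq_conj, AddChar.map_neg_eq_inv]

theorem memLp_halfLine_of_continuous {f : ℝ → ℂ} (hf : Continuous f)
    (hfc : HasCompactSupport f) : MemLp f 2 halfLine :=
  (hf.memLp_of_hasCompactSupport hfc).restrict _

theorem inner_conj_toLp {g : ℝ → ℂ} (hg : MemLp (fun ξ => starRingEnd ℂ (g ξ)) 2 halfLine)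
    (F : Lp ℂ 2 halfLine) : inner ℂ (hg.toLp _) F = ∫ ξ, F ξ * g ξ ∂halfLine := by
  rw [L2.inner_def]
  refine integral_congr_ae ?_
  filter_upwards [hg.coeFn_toLp] with ξ h
  rw [h, RCLike.inner_apply, Complex.conj_conj]

theorem isDistributionalIntegralOperator_halfLineOp (k : ℕ) {b : ℝ → ℂ} (hb : MemLp b ⊤ volume) :
    IsDistributionalIntegralOperator (kernelB k) (fourierDist hb)
      (halfLineOp k (memLp_horizontal hb)) := by
  intro f g hf hfc hf0 hg hgc hg0
  refine ⟨testPairingSchwartz k hf hfc hf0 hg hgc hg0, fun s => rfl, fun F hF => ?_⟩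
  have hgL : MemLp (fun ξ => starRingEnd ℂ (g ξ)) 2 halfLine :=
    memLp_halfLine_of_continuous (Complex.continuous_conj.comp hg.continuous)
      (hgc.comp_left (map_zero _))
  set G := hgL.toLp _ with hG
  have hfi : Integrable f := hf.continuous.integrable_of_hasCompactSupport hfc
  have hgi : Integrable g := hg.continuous.integrable_of_hasCompactSupport hgc
  rw [← inner_conj_toLp hgL, inner_halfLineOp]
  have hint := L2.integrable_inner (𝕜 := ℂ) (synthesisₗᵢ k G)
    (mulOp (memLp_horizontal hb) (synthesisₗᵢ k F))
  have hae : (fun z => inner ℂ (synthesisₗᵢ k G z)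
      (mulOp (memLp_horizontal hb) (synthesisₗᵢ k F) z)) =ᵐ[haarG]
      fun z => b z.1 * (𝓕 (fun ξ => (dilatedSymbol k z.2 ξ : ℂ) * g ξ) z.1 * synthesis k f z) := by
    filter_upwards [coeFn_synthesisₗᵢ k G, coeFn_synthesisₗᵢ k F,
      coeFn_mulOp (memLp_horizontal hb) (synthesisₗᵢ k F), ae_haarG_pos] with z h1 h2 h3 hz
    rw [h1, h3, h2, synthesis_congr k hF hz, synthesis_congr k hgL.coeFn_toLp hz,
      RCLike.inner_apply, conj_synthesis_conj k g z.1 z.2]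
    ring
  have hint' : Integrable (fun z : ℝ × ℝ => b z.1 * (𝓕 (fun ξ =>
      (dilatedSymbol k z.2 ξ : ℂ) * g ξ) z.1 * synthesis k f z)) (volume.prod scaleMeasure) :=
    hint.congr hae
  -- With `u` as the outer variable, `b(u)` leaves the `v`-integral, and what remains inside is the
  -- Fourier transform of the test function.
  rw [L2.inner_def, integral_congr_ae hae, haarG_eq_prod, integral_prod _ hint',
    fourierDist, TemperedDistribution.fourier_apply, Lp.toTemperedDistribution_apply]
  refine integral_congr_ae ?_
  filter_upwards [hb.coeFn_toLp] with u hu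
  rw [hu, integral_const_mul, integral_fourier_mul_synthesis k hfi
    (eq_zero_of_tsupport_subset_Ioi hf0) hgi (eq_zero_of_tsupport_subset_Ioi hg0),
    SchwartzMap.fourier_coe, smul_eq_mul, mul_comm]
  rfl

/-! ### Square integrable horizontal symbols -/

theorem integrable_mul_mul_of_norm_le_one {μ : Measure ℝ} {m χ g : ℝ → ℂ}
    (hm : AEStronglyMeasurable m μ) (hm1 : ∀ᵐ x ∂μ, ‖m x‖ ≤ 1) (hχ : MemLp χ 2 μ)
    (hg : MemLp g 2 μ) :
    Integrable (fun x => m x * χ x * g x) μ ∧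
      ∫ x, ‖m x * χ x * g x‖ ∂μ ≤ ∫ x, ‖χ x‖ ^ 2 ∂μ + ∫ x, ‖g x‖ ^ 2 ∂μ := by
  have hχ2 := (memLp_two_iff_integrable_sq_norm hχ.1).1 hχ
  have hg2 := (memLp_two_iff_integrable_sq_norm hg.1).1 hg
  have hle : ∀ᵐ x ∂μ, ‖m x * χ x * g x‖ ≤ ‖χ x‖ ^ 2 + ‖g x‖ ^ 2 := by
    filter_upwards [hm1] with x hx
    rw [norm_mul, norm_mul]
    have h1 : ‖m x‖ * ‖χ x‖ * ‖g x‖ ≤ ‖χ x‖ * ‖g x‖ :=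
      mul_le_mul_of_nonneg_right (mul_le_of_le_one_left (norm_nonneg _) hx) (norm_nonneg _)
    nlinarith [sq_nonneg (‖χ x‖ - ‖g x‖), sq_nonneg ‖χ x‖, sq_nonneg ‖g x‖]
  have hi : Integrable (fun x => m x * χ x * g x) μ :=
    (hχ2.add hg2).mono' ((hm.mul hχ.1).mul hg.1) hle
  refine ⟨hi, ?_⟩
  rw [← integral_add hχ2 hg2]
  exact integral_mono_ae hi.norm (hχ2.add hg2) hle

theorem measurable_kernelB_ofReal (k : ℕ) :
    Measurable fun z : ℝ × ℝ => (kernelB k z.1 z.2 : ℂ) :=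
  Complex.measurable_ofReal.comp (measurable_kernelB k)

theorem norm_kernelB_le_one (k : ℕ) {ξ t : ℝ} (hξ : 0 < ξ) (ht : 0 < t) :
    ‖(kernelB k ξ t : ℂ)‖ ≤ 1 := by
  rw [Complex.norm_real]
  exact abs_kernelB_le_one k hξ ht

theorem memLp_comp_sub_left {β : ℝ → ℂ} (hβ : MemLp β 2 volume) (c : ℝ) :
    MemLp (fun t => β (c - t)) 2 volume :=
  hβ.comp_measurePreserving (Measure.measurePreserving_sub_left volume c)

theorem memLp_comp_sub_right {β : ℝ → ℂ} (hβ : MemLp β 2 volume) (c : ℝ) :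
    MemLp (fun t => β (t - c)) 2 volume :=
  hβ.comp_measurePreserving (measurePreserving_sub_right volume c)

theorem integral_halfLine_norm_sq_le {β : ℝ → ℂ} (hβ : MemLp β 2 volume) :
    ∫ t, ‖β t‖ ^ 2 ∂halfLine ≤ ∫ t, ‖β t‖ ^ 2 :=
  setIntegral_le_integral ((memLp_two_iff_integrable_sq_norm hβ.1).1 hβ)
    (Filter.Eventually.of_forall fun _ => sq_nonneg _)

/-- Translation invariance makes the bound independent of `ξ`; this uniformity drives the later
Fubini and local integrability arguments. -/
theorem integrable_kernelB_mul_left (k : ℕ) {β γ : ℝ → ℂ} (hβ : MemLp β 2 volume)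
    (hγ : MemLp γ 2 halfLine) {ξ : ℝ} (hξ : 0 < ξ) :
    Integrable (fun t => (kernelB k ξ t : ℂ) * β (ξ - t) * γ t) halfLine ∧
      ∫ t, ‖(kernelB k ξ t : ℂ) * β (ξ - t) * γ t‖ ∂halfLine
        ≤ (∫ t, ‖β t‖ ^ 2) + ∫ t, ‖γ t‖ ^ 2 ∂halfLine := by
  have h1 := memLp_comp_sub_left hβ ξ
  have h := integrable_mul_mul_of_norm_le_one (μ := halfLine)
    ((measurable_kernelB_ofReal k).comp measurable_prodMk_left).aestronglyMeasurable
    (by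
      filter_upwards [ae_restrict_mem measurableSet_Ioi] with t ht
      exact norm_kernelB_le_one k hξ ht) (h1.restrict _) hγ
  refine ⟨h.1, h.2.trans (add_le_add_left ?_ _)⟩
  exact (integral_halfLine_norm_sq_le h1).trans_eq
    (integral_sub_left_eq_self (fun t => ‖β t‖ ^ 2) volume ξ)

theorem integrable_kernelB_mul_right (k : ℕ) {β g : ℝ → ℂ} (hβ : MemLp β 2 volume)
    (hg : MemLp g 2 halfLine) {t : ℝ} (ht : 0 < t) :
    Integrable (fun ξ => (kernelB k ξ t : ℂ) * β (ξ - t) * g ξ) halfLine ∧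
      ∫ ξ, ‖(kernelB k ξ t : ℂ) * β (ξ - t) * g ξ‖ ∂halfLine
        ≤ (∫ ξ, ‖β ξ‖ ^ 2) + ∫ ξ, ‖g ξ‖ ^ 2 ∂halfLine := by
  have h1 := memLp_comp_sub_right hβ t
  have h := integrable_mul_mul_of_norm_le_one (μ := halfLine)
    ((measurable_kernelB_ofReal k).comp measurable_prodMk_right).aestronglyMeasurable
    (by
      filter_upwards [ae_restrict_mem measurableSet_Ioi] with ξ hξ
      exact norm_kernelB_le_one k hξ ht) (h1.restrict _) hg
  refine ⟨h.1, h.2.trans (add_le_add_left ?_ _)⟩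
  exact (integral_halfLine_norm_sq_le h1).trans_eq
    (integral_sub_right_eq_self (fun t => ‖β t‖ ^ 2) t)

theorem integrable_prod_kernelB_mul (k : ℕ) {β γ g : ℝ → ℂ} (hβm : StronglyMeasurable β)
    (hβ : MemLp β 2 volume) (hγ : MemLp γ 2 halfLine) (hg : Integrable g)
    (hg0 : ∀ ξ ≤ 0, g ξ = 0) :
    Integrable (fun p : ℝ × ℝ => (kernelB k p.2 p.1 : ℂ) * β (p.2 - p.1) * γ p.1 * g p.2)
      (halfLine.prod volume) := by
  have hm1 : AEStronglyMeasurable (fun p : ℝ × ℝ => (kernelB k p.2 p.1 : ℂ))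
      (halfLine.prod volume) :=
    ((measurable_kernelB_ofReal k).comp measurable_swap).aestronglyMeasurable
  have hm2 : AEStronglyMeasurable (fun p : ℝ × ℝ => β (p.2 - p.1)) (halfLine.prod volume) :=
    (hβm.comp_measurable (measurable_snd.sub measurable_fst)).aestronglyMeasurable
  have hm := ((hm1.mul hm2).mul hγ.1.comp_fst).mul (hg.1.comp_snd (μ := halfLine))
  refine (integrable_prod_iff' hm).2 ⟨?_, ?_⟩
  · refine Filter.Eventually.of_forall fun ξ => ?_
    rcases le_or_gt ξ 0 with h0 | h0
    · simp [hg0 ξ h0]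
    · exact (integrable_kernelB_mul_left k hβ hγ h0).1.mul_const (g ξ)
  · refine (hg.norm.const_mul ((∫ t, ‖β t‖ ^ 2) + ∫ t, ‖γ t‖ ^ 2 ∂halfLine)).mono'
      hm.norm.prod_swap.integral_prod_right' (Filter.Eventually.of_forall fun ξ => ?_)
    rcases le_or_gt ξ 0 with h0 | h0
    · simp [hg0 ξ h0]
    · simp only [Pi.mul_apply, norm_mul _ (g ξ), integral_mul_const]
      rw [norm_mul, norm_norm, Real.norm_of_nonneg (integral_nonneg fun _ => norm_nonneg _)]
      exact mul_le_mul_of_nonneg_right (integrable_kernelB_mul_left k hβ hγ h0).2 (norm_nonneg _)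

/-- The transposed integral operator `t ↦ ∫ B_k(ξ, t) β(ξ - t) g(ξ) dξ`. -/
def transposeIntegral (k : ℕ) (β g : ℝ → ℂ) (t : ℝ) : ℂ :=
  ∫ ξ, (kernelB k ξ t : ℂ) * β (ξ - t) * g ξ

theorem fourierDist_apply_of_memLp_two {b : ℝ → ℂ} (hb : MemLp b ⊤ volume) (h2 : MemLp b 2 volume)
    (Φ : 𝓢(ℝ, ℂ)) :
    fourierDist hb Φ = ∫ s, Φ s * (𝓕 (h2.toLp b) : Lp ℂ 2 (volume : Measure ℝ)) s := by
  have h := congrArg (fun T : 𝓢'(ℝ, ℂ) => T Φ) (Lp.fourier_toTemperedDistribution_eq (h2.toLp b))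
  simp only [TemperedDistribution.fourier_apply, Lp.toTemperedDistribution_apply,
    smul_eq_mul] at h
  rw [← h, fourierDist, TemperedDistribution.fourier_apply, Lp.toTemperedDistribution_apply]
  refine integral_congr_ae ?_
  filter_upwards [hb.coeFn_toLp, h2.coeFn_toLp] with x h1 h3
  rw [h1, h3, smul_eq_mul]

theorem integral_halfLineOp_mul_of_test (k : ℕ) {b : ℝ → ℂ} (hb : MemLp b ⊤ volume)
    (h2 : MemLp b 2 volume) {f g : ℝ → ℂ} (hf : ContDiff ℝ ∞ f)
    (hfc : HasCompactSupport f) (hf0 : tsupport f ⊆ Ioi 0) (hg : ContDiff ℝ ∞ g)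
    (hgc : HasCompactSupport g) (hg0 : tsupport g ⊆ Ioi 0) (F : Lp ℂ 2 halfLine)
    (hF : F =ᵐ[halfLine] f) :
    ∫ ξ, halfLineOp k (memLp_horizontal hb) F ξ * g ξ ∂halfLine
      = ∫ t, f t * transposeIntegral k
        (𝓕 (h2.toLp b) : Lp ℂ 2 (volume : Measure ℝ)) g t ∂halfLine := by
  obtain ⟨Φ, hΦ, h⟩ := isDistributionalIntegralOperator_halfLineOp k hb f g hf hfc hf0 hg hgc hg0
  rw [h F hF, fourierDist_apply_of_memLp_two hb h2]
  set β : Lp ℂ 2 (volume : Measure ℝ) := 𝓕 (h2.toLp b)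
  have hs := integral_shear (integrable_prod_kernelB_mul k (Lp.stronglyMeasurable β) (Lp.memLp β)
    (memLp_halfLine_of_continuous hf.continuous hfc)
    (hg.continuous.integrable_of_hasCompactSupport hgc) (eq_zero_of_tsupport_subset_Ioi hg0))
  refine Eq.trans ?_ (hs.symm.trans ?_)
  · congr 1
    funext s
    rw [hΦ, ← integral_mul_const]
    congr 1
    funext t
    rw [add_sub_cancel_left]
    ring
  · congr 1
    funext t
    rw [transposeIntegral, ← integral_const_mul]
    congr 1
    funext ξ
    ring

instance : IsLocallyFiniteMeasure halfLine := by unfold halfLine; infer_instance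

/-- Test functions supported away from `0` suffice because `(0, ∞)` is open and carries the whole
measure. -/
theorem ae_eq_halfLine_of_integral_test_eq {f f' : ℝ → ℂ} (hf : LocallyIntegrable f halfLine)
    (hf' : LocallyIntegrable f' halfLine)
    (h : ∀ g : ℝ → ℂ, ContDiff ℝ ∞ g → HasCompactSupport g → tsupport g ⊆ Ioi 0 →
      ∫ x, g x * f x ∂halfLine = ∫ x, g x * f' x ∂halfLine) : f =ᵐ[halfLine] f' := by
  have h0 := isOpen_Ioi.ae_eq_zero_of_integral_contDiff_smul_eq_zero (μ := halfLine)
    (U := Ioi (0 : ℝ)) ((hf.sub hf').locallyIntegrableOn _) (fun g hg hgc hg0 => by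
      have hi : ∀ {f : ℝ → ℂ}, LocallyIntegrable f halfLine →
          Integrable (fun x => g x • f x) halfLine := fun hf =>
        hf.integrable_smul_left_of_hasCompactSupport hg.continuous hgc
      have hts : tsupport (fun x => (g x : ℂ)) ⊆ tsupport g :=
        closure_mono fun x hx hgx => hx (by simp [hgx])
      have h1 := h (fun x => (g x : ℂ)) (Complex.ofRealCLM.contDiff.comp hg)
        (hgc.comp_left (g := Complex.ofReal) Complex.ofReal_zero) (hts.trans hg0)
      simp only [Pi.sub_apply, smul_sub]
      rw [integral_sub (hi hf) (hi hf'), sub_eq_zero]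
      simpa only [Complex.real_smul] using h1)
  filter_upwards [h0, ae_restrict_mem measurableSet_Ioi] with x h1 hx
  exact sub_eq_zero.1 (h1 hx)

theorem locallyIntegrable_of_norm_le {f : ℝ → ℂ} (hf : AEStronglyMeasurable f halfLine) (C : ℝ)
    (hC : ∀ t, 0 < t → ‖f t‖ ≤ C) : LocallyIntegrable f halfLine :=
  (memLp_top_of_bound hf C (by
    filter_upwards [ae_restrict_mem measurableSet_Ioi] with t ht
    exact hC t ht)).locallyIntegrable le_top

theorem locallyIntegrable_transposeIntegral (k : ℕ) {β g : ℝ → ℂ} (hβm : StronglyMeasurable β)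
    (hβ : MemLp β 2 volume) (hgm : StronglyMeasurable g) (hg : MemLp g 2 halfLine)
    (hg0 : ∀ ξ ≤ 0, g ξ = 0) : LocallyIntegrable (transposeIntegral k β g) halfLine := by
  refine locallyIntegrable_of_norm_le ?_ ((∫ ξ, ‖β ξ‖ ^ 2) + ∫ ξ, ‖g ξ‖ ^ 2 ∂halfLine)
    fun t ht => ?_
  · refine (StronglyMeasurable.integral_prod_right' (f := fun p : ℝ × ℝ =>
      (kernelB k p.2 p.1 : ℂ) * β (p.2 - p.1) * g p.2) ?_).aestronglyMeasurable
    exact (((measurable_kernelB_ofReal k).comp measurable_swap).stronglyMeasurable.mul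
      (hβm.comp_measurable (measurable_snd.sub measurable_fst))).mul
      (hgm.comp_measurable measurable_snd)
  · rw [transposeIntegral, ← setIntegral_halfLine_eq fun ξ h => by rw [hg0 ξ h, mul_zero]]
    exact (norm_integral_le_integral_norm _).trans (integrable_kernelB_mul_right k hβ hg ht).2

theorem locallyIntegrable_integral_kernelB (k : ℕ) {β γ : ℝ → ℂ} (hβm : StronglyMeasurable β)
    (hβ : MemLp β 2 volume) (hγm : StronglyMeasurable γ) (hγ : MemLp γ 2 halfLine) :
    LocallyIntegrable (fun ξ => ∫ t, (kernelB k ξ t : ℂ) * β (ξ - t) * γ t ∂halfLine)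
      halfLine := by
  refine locallyIntegrable_of_norm_le ?_ ((∫ ξ, ‖β ξ‖ ^ 2) + ∫ ξ, ‖γ ξ‖ ^ 2 ∂halfLine)
    fun ξ hξ => ?_
  · refine (StronglyMeasurable.integral_prod_right' (f := fun p : ℝ × ℝ =>
      (kernelB k p.1 p.2 : ℂ) * β (p.1 - p.2) * γ p.2) ?_).aestronglyMeasurable
    exact ((measurable_kernelB_ofReal k).stronglyMeasurable.mul
      (hβm.comp_measurable (measurable_fst.sub measurable_snd))).mul
      (hγm.comp_measurable measurable_snd)
  · exact (norm_integral_le_integral_norm _).trans (integrable_kernelB_mul_left k hβ hγ hξ).2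

/-- The transposed integral is not known in advance to be in `L_2`, so density in `F` is not
immediate. Instead the adjoint represents the left side by an `L_2` function, and testing identifies
that function with the transposed integral almost everywhere. -/
theorem integral_halfLineOp_mul (k : ℕ) {b : ℝ → ℂ} (hb : MemLp b ⊤ volume)
    (h2 : MemLp b 2 volume) {g : ℝ → ℂ} (hg : ContDiff ℝ ∞ g)
    (hgc : HasCompactSupport g) (hg0 : tsupport g ⊆ Ioi 0) (F : Lp ℂ 2 halfLine) :
    ∫ ξ, halfLineOp k (memLp_horizontal hb) F ξ * g ξ ∂halfLine
      = ∫ t, F t * transposeIntegral k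
        (𝓕 (h2.toLp b) : Lp ℂ 2 (volume : Measure ℝ)) g t ∂halfLine := by
  set β : Lp ℂ 2 (volume : Measure ℝ) := 𝓕 (h2.toLp b) with hβ
  set T := halfLineOp k (memLp_horizontal hb) with hT
  have hgL : MemLp (fun ξ => starRingEnd ℂ (g ξ)) 2 halfLine :=
    memLp_halfLine_of_continuous (Complex.continuous_conj.comp hg.continuous)
      (hgc.comp_left (map_zero _))
  set A := ContinuousLinearMap.adjoint T (hgL.toLp _) with hA
  have hadj : ∀ F, ∫ ξ, T F ξ * g ξ ∂halfLine = ∫ t, F t * starRingEnd ℂ (A t) ∂halfLine :=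
    fun F => by
      rw [← inner_conj_toLp hgL, ← ContinuousLinearMap.adjoint_inner_left, L2.inner_def]
      rfl
  have hAc : LocallyIntegrable (fun t => starRingEnd ℂ (A t)) halfLine :=
    (Lp.memLp A).star.locallyIntegrable one_le_two
  have key : (fun t => starRingEnd ℂ (A t)) =ᵐ[halfLine] transposeIntegral k β g := by
    refine ae_eq_halfLine_of_integral_test_eq hAc (locallyIntegrable_transposeIntegral k
      (Lp.stronglyMeasurable β) (Lp.memLp β) hg.continuous.stronglyMeasurable
      (memLp_halfLine_of_continuous hg.continuous hgc) (eq_zero_of_tsupport_subset_Ioi hg0))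
      fun f hf hfc hf0 => ?_
    have hfL := memLp_halfLine_of_continuous hf.continuous hfc
    rw [← integral_halfLineOp_mul_of_test k hb h2 hf hfc hf0 hg hgc hg0 (hfL.toLp f)
      hfL.coeFn_toLp, hadj]
    refine integral_congr_ae ?_
    filter_upwards [hfL.coeFn_toLp] with t ht
    rw [ht]
  rw [hadj]
  refine integral_congr_ae ?_
  filter_upwards [key] with t ht
  rw [ht]

/-- Fubini carries the transposed integral back to the original one under a test function `g`; both
sides are locally integrable, so they agree almost everywhere. -/
theorem isIntegralOperator_halfLineOp (k : ℕ) {b : ℝ → ℂ} (hb : MemLp b ⊤ volume)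
    (h2 : MemLp b 2 volume) :
    IsIntegralOperator (fun ξ t => (kernelB k ξ t : ℂ) *
      (𝓕 (h2.toLp b) : Lp ℂ 2 (volume : Measure ℝ)) (ξ - t))
      (halfLineOp k (memLp_horizontal hb)) := by
  intro F
  have key := ae_eq_halfLine_of_integral_test_eq
    ((Lp.memLp (halfLineOp k (memLp_horizontal hb) F)).locallyIntegrable one_le_two)
    (locallyIntegrable_integral_kernelB k
      (Lp.stronglyMeasurable (𝓕 (h2.toLp b) : Lp ℂ 2 (volume : Measure ℝ))) (Lp.memLp _)
      (Lp.stronglyMeasurable F) (Lp.memLp F)) fun g hg hgc hg0 => by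
    set β : Lp ℂ 2 (volume : Measure ℝ) := 𝓕 (h2.toLp b) with hβ
    have hg0' := eq_zero_of_tsupport_subset_Ioi hg0
    have hi := integrable_prod_kernelB_mul k (Lp.stronglyMeasurable β) (Lp.memLp β) (Lp.memLp F)
      (hg.continuous.integrable_of_hasCompactSupport hgc) hg0'
    have h := integral_halfLineOp_mul k hb h2 hg hgc hg0 F
    simp only [mul_comm (g _)]
    refine h.trans (Eq.trans ?_ (setIntegral_halfLine_eq fun ξ h => by
      rw [hg0' ξ h, mul_zero]).symm)
    refine Eq.trans ?_ ((integral_integral_swap (f := fun t ξ : ℝ =>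
      (kernelB k ξ t : ℂ) * β (ξ - t) * F t * g ξ) hi).trans ?_)
    · congr 1
      funext t
      rw [transposeIntegral, ← integral_const_mul]
      congr 1
      funext ξ
      ring
    · congr 1
      funext ξ
      rw [← integral_mul_const]
  filter_upwards [key, ae_restrict_mem measurableSet_Ioi] with ξ h1 hξ
  exact ⟨(integrable_kernelB_mul_left k (Lp.memLp _) (Lp.memLp F) hξ).1, h1⟩

/-! ### Integrable horizontal symbols. -/

theorem memLp_two_of_integrable_of_memLp_top {b : ℝ → ℂ} (hi : Integrable b)
    (hb : MemLp b ⊤ volume) : MemLp b 2 volume := by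
  rw [memLp_two_iff_integrable_sq_norm hb.1]
  have hfin : eLpNormEssSup b volume ≠ ⊤ := by
    have := hb.2.ne
    rwa [eLpNorm_exponent_top] at this
  refine (hi.norm.const_mul (eLpNormEssSup b volume).toReal).mono' (hb.1.norm.pow 2) ?_
  filter_upwards [ae_le_eLpNormEssSup (f := b) (μ := volume)] with u hu
  have h : ‖b u‖ ≤ (eLpNormEssSup b volume).toReal := by
    rw [← toReal_enorm]
    exact ENNReal.toReal_mono hfin hu
  rw [Real.norm_of_nonneg (sq_nonneg _), sq]
  exact mul_le_mul_of_nonneg_right h (norm_nonneg _)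

theorem isIntegralOperator_halfLineOp_of_integrable (k : ℕ) {b : ℝ → ℂ} (hb : MemLp b ⊤ volume)
    (hi : Integrable b) :
    IsIntegralOperator (fun ξ t => (kernelB k ξ t : ℂ) * 𝓕 b (ξ - t))
      (halfLineOp k (memLp_horizontal hb)) := by
  have h2 := memLp_two_of_integrable_of_memLp_top hi hb
  intro F
  filter_upwards [isIntegralOperator_halfLineOp k hb h2 F] with ξ ⟨h3, h4⟩
  have h5 : (fun t => (kernelB k ξ t : ℂ) *
      (𝓕 (h2.toLp b) : Lp ℂ 2 (volume : Measure ℝ)) (ξ - t) * F t) =ᵐ[halfLine]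
      fun t => (kernelB k ξ t : ℂ) * 𝓕 b (ξ - t) * F t := by
    -- The two Fourier transforms agree off a null set, and `t ↦ ξ - t` pulls null sets back to null
    -- sets.
    have h6 := (Measure.measurePreserving_sub_left volume ξ).quasiMeasurePreserving.ae_eq_comp
      (coeFn_fourier_toLp hi h2)
    filter_upwards [ae_restrict_of_ae h6] with t ht
    exact congrArg (fun w => (kernelB k ξ t : ℂ) * w * F t) ht
  exact ⟨h3.congr h5, h4.trans (integral_congr_ae h5)⟩

end CalderonToeplitz

end

open CalderonToeplitz in
theorem mainTheorem9 (k : ℕ) :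
    ∃ _ : (waveletSpace k).HasOrthogonalProjection,
    ∃ R : waveletSpace k ≃ₗᵢ[ℂ] Lp ℂ 2 halfLine,
    ∀ (b : ℝ → ℂ) (hb : MemLp b ⊤ volume),
    ∃ 𝔅 : Lp ℂ 2 halfLine →L[ℂ] Lp ℂ 2 halfLine,
      (∀ F : waveletSpace k, R (toeplitzOp k (memLp_horizontal hb) F) = 𝔅 (R F)) ∧
      IsDistributionalIntegralOperator (kernelB k) (fourierDist hb) 𝔅 ∧
      (Integrable b volume →
        IsIntegralOperator (fun ξ t => (kernelB k ξ t : ℂ) * 𝓕 b (ξ - t)) 𝔅) ∧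
      (∀ h2 : MemLp b 2 volume,
        IsIntegralOperator (fun ξ t => (kernelB k ξ t : ℂ) *
          (𝓕 (h2.toLp b) : Lp ℂ 2 (volume : Measure ℝ)) (ξ - t)) 𝔅) :=
  ⟨hasOrthogonalProjection_waveletSpace k, bargmannₗᵢ k, fun _ hb =>
    ⟨halfLineOp k (memLp_horizontal hb), bargmannₗᵢ_toeplitzOp k _,
      isDistributionalIntegralOperator_halfLineOp k hb,
      isIntegralOperator_halfLineOp_of_integrable k hb, isIntegralOperator_halfLineOp k hb⟩⟩
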